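/- Let $N\ge 2$, and let $\kappa_N=(-1)^{N/2+1}$ if $N$ is even and $\kappa_N\in\{1,-1\}$ if $N$ is odd. Let $I\subseteq\mathbb{R}$ be open, let $u_0,\dots,u_{N-2}:I\to\mathbb{C}$ be smooth, and put $$\mathcal{L}=\partial_x^N+u_{N-2}(x)\partial_x^{N-2}+\cdots+u_0(x),\qquad \mathcal{L}^*f=(-1)^N\partial_x^Nf+\sum_{i=0}^{N-2}(-1)^i\partial_x^i(u_if).$$ For a sign $\sigma$ admissible as $\kappa_N$ above, let $$A_N(z;\sigma)=\frac{1}{2\pi i}\int_{c-i\infty}^{c+i\infty}e^{z\xi+\sigma\xi^N}\,d\xi,$$ where $c=0$ if $N$ is even, $c=1$ if $N$ is odd and $\sigma=(-1)^{(N+1)/2}$, and $c=-1$ if $N$ is odd and $\sigma=(-1)^{(N-1)/2}$. Let $Q$ be a linear differential operator on $I$ with leading term $\sigma\partial_x^N$. The functions $H_k^j(x,y)$, $k\ge 1$, $0\le j\le N-2$, are called Hadamard coefficients of the equation $\partial_tv=Qv$ on an open neighbourhood $U\subseteq I\times I$ of the diagonal $\{(x,x):x\in I\}$ if they are smooth on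 $U$ and the formal series $$\frac{1}{t^{1/N}}A_N\Big(\frac{x-y}{t^{1/N}};\sigma\Big)+\sum_{j=0}^{N-2}\frac{1}{t^{(j+1)/N}}A_N^{(j)}\Big(\frac{x-y}{t^{1/N}};\sigma\Big)\sum_{k=1}^{\infty}H_k^j(x,y)t^k\qquad(t>0)$$ is, for fixed $y$, a formal solution of $\partial_tv=Qv$, that is: for every $K\ge 0$ there are functions $r_0,\dots,r_{N-2}$ on $U$ such that, for the partial sum $\mathcal{H}_K$ over $k\le K$, $$(\partial_t-Q)\mathcal{H}_K(x,y,t)=t^K\sum_{j=0}^{N-2}r_j(x,y)\,t^{-(j+1)/N}A_N^{(j)}\Big(\frac{x-y}{t^{1/N}};\sigma\Big)\qquad\text{for }(x,y)\in U,\ t>0.$$ Let $H_n^j$ be Hadamard coefficients of the heat equation $\partial_tv=\kappa_N\mathcal{L}v$ (with $\sigma=\kappa_N$) on $U$, and let $\tilde H_n^j$ be Hadamard coefficients of the dual equation $\partial_tv=\kappa_N\mathcal{L}^*v$ (with $\sigma=(-1)^N\kappa_N$) on $V$, where $U,V\subseteq I\times I$ are open neighbourhoods of the diagonal. Then $$H_n^j(x,y)=(-1)^j\,\tilde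 H_n^j(y,x)\qquad\text{for all } n\ge 1,\ 0\le j\le N-2,$$ for all $(x,y)$ near the diagonal, namely whenever the closed square $J\times J$, with $J$ the closed interval with endpoints $x$ and $y$, is contained in $U\cap V$. -/

import Mathlib

open scoped ContDiff

noncomputable section

namespace HeatExpansion

/-- The admissible signs `κ_N`: `(-1)^(N/2+1)` if `N` is even, either of `±1` if `N` is odd. -/
def IsHeatSign (N : ℕ) (κ : ℝ) : Prop :=
  (Even N → κ = (-1) ^ (N / 2 + 1)) ∧ (Odd N → κ = 1 ∨ κ = -1)

/-- The abscissa `c` of the vertical line over which the Airy-type integral is taken. It is `0` for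
even `N`; for odd `N` it is `1` if `κ = (-1)^((N+1)/2)` and `-1` if `κ = (-1)^((N-1)/2)`, which
makes the integral absolutely convergent. -/
def airyAbscissa (N : ℕ) (κ : ℝ) : ℝ :=
  if Even N then 0 else if κ = (-1) ^ ((N + 1) / 2) then 1 else -1

/-- The Airy-type function `A_N(z; κ) = (1 / 2πi) ∫_{c - i∞}^{c + i∞} exp (z ξ + κ ξ^N) dξ`,
with the line of integration parametrized by `ξ = c + i s`, `s ∈ ℝ`. -/
def airyType (N : ℕ) (κ : ℝ) (z : ℝ) : ℂ :=
  (1 / (2 * Real.pi) : ℂ) * ∫ s : ℝ,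
    Complex.exp ((z : ℂ) * ((airyAbscissa N κ : ℂ) + Complex.I * (s : ℂ))
      + (κ : ℂ) * ((airyAbscissa N κ : ℂ) + Complex.I * (s : ℂ)) ^ N)

/-- `t^{-(j+1)/N} A_N^{(j)} ((x - y) / t^{1/N}; κ)`, for `t > 0`. -/
def airyTerm (N : ℕ) (κ : ℝ) (j : ℕ) (x y t : ℝ) : ℂ :=
  ((t ^ (-((j : ℝ) + 1) / (N : ℝ)) : ℝ) : ℂ) *
    iteratedDeriv j (airyType N κ) ((x - y) / t ^ (1 / (N : ℝ)))

/-- The partial sum, over the powers `t^k` with `k ≤ K`, of the heat kernel expansion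
`t^{-1/N} A_N(⋯) + ∑_{j=0}^{N-2} t^{-(j+1)/N} A_N^{(j)}(⋯) ∑_{k ≥ 1} H_k^j(x,y) t^k`;
the coefficient `H_k^j(x,y)` is `H k j x y`. -/
def heatKernelTrunc (N : ℕ) (κ : ℝ) (H : ℕ → ℕ → ℝ → ℝ → ℂ) (K : ℕ) (x y t : ℝ) : ℂ :=
  airyTerm N κ 0 x y t + ∑ j ∈ Finset.range (N - 1),
    airyTerm N κ j x y t * ∑ k ∈ Finset.Icc 1 K, H k j x y * (t : ℂ) ^ k

/-- The differential operator `L = ∂^N + u_{N-2} ∂^{N-2} + ⋯ + u_0`. -/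
def opL (N : ℕ) (u : ℕ → ℝ → ℂ) (f : ℝ → ℂ) (x : ℝ) : ℂ :=
  iteratedDeriv N f x + ∑ i ∈ Finset.range (N - 1), u i x * iteratedDeriv i f x

/-- The formal adjoint of `opL`,
`L^* f = (-1)^N ∂^N f + ∑_{i=0}^{N-2} (-1)^i ∂^i (u_i f)`. -/
def opLAdj (N : ℕ) (u : ℕ → ℝ → ℂ) (f : ℝ → ℂ) (x : ℝ) : ℂ :=
  (-1) ^ N * iteratedDeriv N f x +
    ∑ i ∈ Finset.range (N - 1), (-1) ^ i * iteratedDeriv i (fun s => u i s * f s) x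

/-- `H` is a family of Hadamard coefficients `H_k^j` (`k ≥ 1`, `0 ≤ j ≤ N - 2`), on the
neighbourhood `U` of the diagonal, for the heat equation `∂_t v = Q v`, where `Q` is a linear
differential operator in `x` with leading term `σ ∂^N` and `σ` is an admissible sign.

The last condition says that the formal series solves the equation: substituting it leaves no term
`t^k t^{-(j+1)/N} A_N^{(j)}((x - y) / t^{1/N}; σ)` with `k < K`, for any `K`. As `∂_t - Q` maps
the coefficient of `t^k` in the expansion to the powers `t^{k-1}` and `t^k` only, this is tested
on the partial sum up to `t^K`, whose defect must be of order exactly `t^K`. -/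
structure IsHadamard (N : ℕ) (σ : ℝ) (Q : (ℝ → ℂ) → ℝ → ℂ) (U : Set (ℝ × ℝ))
    (H : ℕ → ℕ → ℝ → ℝ → ℂ) : Prop where
  smooth : ∀ k j : ℕ, 1 ≤ k → j < N - 1 →
    ContDiffOn ℝ ∞ (fun p : ℝ × ℝ => H k j p.1 p.2) U
  solves : ∀ K : ℕ, ∃ r : ℕ → ℝ → ℝ → ℂ, ∀ x y t : ℝ, (x, y) ∈ U → 0 < t →
    deriv (fun τ => heatKernelTrunc N σ H K x y τ) t
        - Q (fun s => heatKernelTrunc N σ H K s y t) x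
      = (t : ℂ) ^ K * ∑ j ∈ Finset.range (N - 1), r j x y * airyTerm N σ j x y t

end HeatExpansion

end

/-! A finite sum of terms `c(x,y) t^k t^{-(j+1)/N} A_N^{(j)}((x-y)/t^{1/N})` is encoded by its
symbol `∑ c t^k ξ^j`, a polynomial in `ξ` (outer variable) and `t` (inner variable). On symbols
`∂_x`, `-∂_y`, `∂_t` act as `∂_x + ξ`, `-∂_y + ξ`, `∂_t + κ ξ^N`. Integration by parts in the Airy
integral says that the image of `∇ = ∂_ξ + w + Nκ t ξ^{N-1}`, with `w = x - y`, represents zero.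
Everything commutes with `∇`, up to coefficients depending on the other variable only, and `P_x =
∂_t - κ L_x` commutes with `P_y = ∂_t - κ L^*_y`. After multiplication by `t`, powers `ξ^n` with `n
≥ N - 1` can be removed modulo `∇` (`red`). Off the diagonal the remaining Airy terms are
independent over polynomials in `t` (`airyTerm_independent`), so the analytic hypotheses become
congruences modulo powers of `t` (`dvd_red_of_evalSym`).

The substitution `ξ ↦ -ξ` turns the dual expansion with `x` and `y` exchanged into an expansion `G`
in the same Airy function, with coefficients `(-1)^j H̃(y,x)`, annihilated by `P_y`. A symbol
starting with `1` is determined by the `x`-equation: the top coefficient `c` of a difference of two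
solutions at order `t^m` satisfies `m c + w ∂_x c = 0`, which has no nonzero smooth solution across
the diagonal when `m ≥ 1`. So it suffices that `G` also solves the `x`-equation (`dvd_red_heatX`).

Let `D = red (P_x G)`. Commutation (`red_heat_comm`) gives `red (P_y D) = D` to the order
considered, hence `(m - 1) c - w ∂_y c = 0` at order `t^m`. Order `0` is absent because `G` starts
with `1`, and orders `m ≥ 2` vanish by transport. At `m = 1` the equation only says that `c` is
constant in `y`, and its value on the diagonal is needed. It is found by pairing with test functions
of `y` as `t → 0`, where `L^*` being the adjoint of `L` makes the contribution of `P_x - P_y` vanish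
(`pair_heat_sub_one_mem`). -/

noncomputable section

open Polynomial

namespace HeatExpansion

/-! ### Polynomials over a ring with derivations -/

section CoeffDerivation

variable {A : Type*} [CommRing A]

section

variable [Algebra ℂ A]

/-- The derivation of `A[X]` which applies a derivation of `A` to every coefficient. -/
def coeffDer (d : Derivation ℂ A A) : Derivation ℂ A[X] A[X] :=
  Derivation.mk'
    { toFun := fun p => p.sum fun n a => monomial n (d a)
      map_add' := fun p q => sum_add_index p q _ (by simp) (by simp)
      map_smul' := fun r p => by
        rw [sum_smul_index' _ _ _ (by simp)]
        simp only [Derivation.map_smul, ← smul_monomial, RingHom.id_apply, Polynomial.sum,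
          Finset.smul_sum] }
    (fun p q => by
      induction p using Polynomial.induction_on' with
      | add p p' h h' => rw [add_mul, map_add, map_add, h, h', add_smul, smul_add]; abel
      | monomial n a =>
        induction q using Polynomial.induction_on' with
        | add q q' h h' => rw [mul_add, map_add, map_add, h, h', add_smul, smul_add]; abel
        | monomial m b =>
          simp only [LinearMap.coe_mk, AddHom.coe_mk, monomial_mul_monomial, smul_eq_mul]
          rw [sum_monomial_index _ _ (by simp), sum_monomial_index _ _ (by simp),
            sum_monomial_index _ _ (by simp)]
          simp only [Derivation.leibniz, smul_eq_mul, map_add, monomial_mul_monomial, add_comm m n])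

@[simp]
lemma coeffDer_monomial (d : Derivation ℂ A A) (n : ℕ) (a : A) :
    coeffDer d (monomial n a) = monomial n (d a) := by
  change (monomial n a).sum (fun n a => monomial n (d a)) = _
  rw [sum_monomial_index _ _ (by simp)]

@[simp]
lemma coeff_coeffDer (d : Derivation ℂ A A) (p : A[X]) (n : ℕ) :
    (coeffDer d p).coeff n = d (p.coeff n) := by
  induction p using Polynomial.induction_on' with
  | add p q hp hq => simp [hp, hq]
  | monomial m a =>
    rw [coeffDer_monomial, coeff_monomial, coeff_monomial]
    split_ifs <;> simp

@[simp]
lemma coeffDer_C (d : Derivation ℂ A A) (a : A) : coeffDer d (C a) = C (d a) :=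
  coeffDer_monomial d 0 a

@[simp]
lemma coeffDer_X (d : Derivation ℂ A A) : coeffDer d (X : A[X]) = 0 := by
  rw [← monomial_one_one_eq_X, coeffDer_monomial]; simp

lemma coeffDer_comm {d d' : Derivation ℂ A A} (h : ∀ a, d (d' a) = d' (d a)) (p : A[X]) :
    coeffDer d (coeffDer d' p) = coeffDer d' (coeffDer d p) := by
  ext n; simp [h]

/-- Formal differentiation of polynomials, as a derivation over `ℂ`. -/
def polyDer : Derivation ℂ A[X] A[X] := (derivative' (R := A)).restrictScalars ℂ

@[simp]
lemma polyDer_apply (p : A[X]) : polyDer p = derivative p := rfl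

lemma coeffDer_polyDer (d : Derivation ℂ A A) (p : A[X]) :
    coeffDer d (polyDer p) = polyDer (coeffDer d p) := by
  ext n
  rw [coeff_coeffDer, polyDer_apply, polyDer_apply, coeff_derivative, coeff_derivative,
    coeff_coeffDer, ← Nat.cast_succ, ← nsmul_eq_mul', ← nsmul_eq_mul', map_nsmul]

end

/-- Division by `X ^ n`, forgetting the remainder. -/
def shiftDown (n : ℕ) : A[X] →ₗ[A] A[X] :=
  ({ toFun := divX
     map_add' := fun _ _ => divX_add
     map_smul' := fun a p => by ext n; simp [coeff_divX] } : Module.End A A[X]) ^ n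

@[simp]
lemma coeff_shiftDown (n : ℕ) (p : A[X]) (m : ℕ) :
    (shiftDown n p).coeff m = p.coeff (m + n) := by
  induction n generalizing p with
  | zero => simp [shiftDown]
  | succ n ih =>
    rw [shiftDown, pow_succ, Module.End.mul_apply]
    refine (ih _).trans ?_
    change (divX p).coeff _ = _
    rw [coeff_divX, add_assoc]

end CoeffDerivation

/-! ### Symbols and the operators on them -/

/-- A commutative algebra with two commuting derivations `∂_x`, `∂_y` and an element `w`, playing
the part of `x - y`, in which the homogeneous transport equations have no nonzero solution,
together with the coefficients of an operator in each of the variables. -/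
structure TransportAlgebra (R : Type*) [CommRing R] [Algebra ℂ R] where
  dx : Derivation ℂ R R
  dy : Derivation ℂ R R
  dx_dy : ∀ c, dx (dy c) = dy (dx c)
  w : R
  dx_w : dx w = 1
  dy_w : dy w = -1
  /-- the elements vanishing on the diagonal -/
  diag : Ideal R
  w_mem : w ∈ diag
  transport_x : ∀ (k : ℕ) (c : R), 1 ≤ k → (k : R) * c + w * dx c = 0 → c = 0
  transport_y : ∀ (k : ℕ) (c : R), 1 ≤ k → (k : R) * c - w * dy c = 0 → c = 0
  -- This replaces the transport equation in the degenerate case `k = 0`, whose solutions are the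
  -- functions constant in `y`.
  eq_zero_of_dy : ∀ c ∈ diag, dy c = 0 → c = 0
  N : ℕ
  two_le : 2 ≤ N
  κ : ℂ
  κ_ne : κ ≠ 0
  ux : ℕ → R
  uy : ℕ → R
  dy_ux : ∀ i, dy (ux i) = 0
  dx_uy : ∀ i, dx (uy i) = 0
  ux_sub_uy_mem : ∀ i, ux i - uy i ∈ diag

namespace TransportAlgebra

variable {R : Type*} [CommRing R] [Algebra ℂ R] (S : TransportAlgebra R)

/-- The operator `d + ξ` on symbols. The symbol `ξ ^ j` stands for the `j`-th derivative of the
fundamental solution. -/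
def symOp (d : Derivation ℂ R R) : Module.End ℂ R[X][X] :=
  (coeffDer (coeffDer d)).toLinearMap + LinearMap.mulLeft ℂ X

/-- `∂_t` on symbols. -/
def opT : Module.End ℂ R[X][X] :=
  (coeffDer polyDer).toLinearMap + LinearMap.mulLeft ℂ (S.κ • X ^ S.N)

/-- The operator whose image consists of the symbols of the zero function. -/
def nabla : Module.End ℂ R[X][X] :=
  polyDer.toLinearMap +
    LinearMap.mulLeft ℂ (C (C S.w) + (S.N * S.κ) • (C X * X ^ (S.N - 1)))

/-- Multiplication of symbols by an element of `R`. -/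
def mulR (c : R) : Module.End ℂ R[X][X] := LinearMap.mulLeft ℂ (C (C c))

/-- `∂_t - κ L_x` on symbols. -/
def heatX : Module.End ℂ R[X][X] :=
  S.opT - S.κ • (symOp S.dx ^ S.N +
    ∑ i ∈ Finset.range (S.N - 1), mulR (S.ux i) * symOp S.dx ^ i)

/-- `∂_t - κ L^*_y` on symbols; `symOp (-S.dy)` represents `-∂_y`. -/
def heatY : Module.End ℂ R[X][X] :=
  S.opT - S.κ • (symOp (-S.dy) ^ S.N +
    ∑ i ∈ Finset.range (S.N - 1), symOp (-S.dy) ^ i * mulR (S.uy i))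

/-! ### Commutation relations -/

lemma symOp_apply (d : Derivation ℂ R R) (p : R[X][X]) :
    symOp d p = coeffDer (coeffDer d) p + X * p := rfl

lemma opT_apply (p : R[X][X]) : S.opT p = coeffDer polyDer p + S.κ • X ^ S.N * p := rfl

lemma nabla_apply (p : R[X][X]) : S.nabla p = derivative p +
    (C (C S.w) + (S.N * S.κ) • (C X * X ^ (S.N - 1))) * p := rfl

lemma mulR_apply (c : R) (p : R[X][X]) : mulR c p = C (C c) * p := rfl

lemma commute_symOp {d d' : Derivation ℂ R R} (h : ∀ c, d (d' c) = d' (d c)) :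
    Commute (symOp d) (symOp d') := by
  refine LinearMap.ext fun p => ?_
  simp only [Module.End.mul_apply, symOp_apply, map_add, Derivation.leibniz,
    coeffDer_X, smul_eq_mul, mul_zero, add_zero]
  rw [coeffDer_comm (coeffDer_comm h)]
  ring

lemma commute_symOp_opT (d : Derivation ℂ R R) : Commute (symOp d) S.opT := by
  refine LinearMap.ext fun p => ?_
  simp only [Module.End.mul_apply, symOp_apply, opT_apply, map_add, Derivation.leibniz,
    Derivation.leibniz_pow, Derivation.map_smul,
    coeffDer_X, smul_eq_mul, mul_zero, add_zero, smul_zero]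
  rw [coeffDer_comm (coeffDer_polyDer d)]
  ring

lemma commute_mulR (c d : R) : Commute (mulR c) (mulR d) := by
  refine LinearMap.ext fun p => ?_
  simp only [Module.End.mul_apply, mulR_apply]
  ring

lemma commute_symOp_mulR {d : Derivation ℂ R R} {c : R} (h : d c = 0) :
    Commute (symOp d) (mulR c) := by
  refine LinearMap.ext fun p => ?_
  simp only [Module.End.mul_apply, mulR_apply, symOp_apply, Derivation.leibniz, coeffDer_C, h,
    map_zero, smul_eq_mul, mul_zero, add_zero]
  ring

lemma commute_opT_mulR (c : R) : Commute S.opT (mulR c) := by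
  refine LinearMap.ext fun p => ?_
  simp only [Module.End.mul_apply, mulR_apply, opT_apply, Derivation.leibniz, coeffDer_C,
    polyDer_apply, derivative_C, map_zero, smul_eq_mul, mul_zero, add_zero]
  ring

lemma commute_nabla_mulR (c : R) : Commute S.nabla (mulR c) := by
  refine LinearMap.ext fun p => ?_
  simp only [Module.End.mul_apply, mulR_apply, nabla_apply, derivative_mul, derivative_C, zero_mul,
    zero_add]
  ring

/-- The commutator `[∂_ξ, ξ] = 1` is cancelled by `[w, d] = -d w = -1`. This covers both `∂_x` and
`-∂_y`. -/
lemma commute_nabla_symOp {d : Derivation ℂ R R} (hd : d S.w = 1) :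
    Commute S.nabla (symOp d) := by
  refine LinearMap.ext fun p => ?_
  have h := coeffDer_polyDer (coeffDer d) p
  simp only [polyDer_apply] at h
  simp only [Module.End.mul_apply, nabla_apply, symOp_apply, derivative_mul,
    derivative_X, map_add, Derivation.leibniz, Derivation.leibniz_pow, Derivation.map_smul,
    coeffDer_C, coeffDer_X, hd, smul_eq_mul, mul_zero, add_zero, smul_zero, map_zero, h,
    map_one]
  ring

/-- Here `[∂_ξ, κ ξ^N] = Nκ ξ^{N-1}` cancels against `[Nκ t ξ^{N-1}, ∂_t]`. -/
lemma commute_nabla_opT : Commute S.nabla S.opT := by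
  refine LinearMap.ext fun p => ?_
  have h := coeffDer_polyDer (polyDer (A := R)) p
  simp only [polyDer_apply] at h
  simp only [Module.End.mul_apply, nabla_apply, opT_apply, derivative_mul,
    derivative_smul, derivative_X_pow,
    derivative_X, derivative_C, map_add, Derivation.leibniz, Derivation.leibniz_pow,
    Derivation.map_smul, polyDer_apply,
    coeffDer_C, coeffDer_X, smul_eq_mul, mul_zero, smul_zero, map_zero, h,
    map_one, zero_add]
  simp only [Algebra.smul_def, map_mul, map_natCast]
  ring

lemma neg_dy_w : (-S.dy) S.w = 1 := by simp [S.dy_w]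

/-- The operators act in different variables: `∂_y` kills the coefficients `ux` and `∂_x` kills
`uy`, so the factors commute one by one. -/
lemma commute_heatX_heatY : Commute S.heatX S.heatY := by
  have hxy : Commute (symOp S.dx) (symOp (-S.dy)) :=
    commute_symOp fun c => by simp [S.dx_dy]
  have hT := S.commute_symOp_opT
  unfold heatX heatY
  refine Commute.sub_left (R := Module.End ℂ R[X][X])
    (Commute.sub_right (R := Module.End ℂ R[X][X]) (Commute.refl _) ?_)
    (Commute.sub_right (R := Module.End ℂ R[X][X]) ?_ ?_)
  · refine .smul_right (.add_right ((hT _).symm.pow_right _) (.sum_right _ _ _ fun i _ => ?_)) _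
    exact ((hT _).symm.pow_right _).mul_right (S.commute_opT_mulR _)
  · refine .smul_left (.add_left ((hT _).pow_left _) (.sum_left _ _ _ fun i _ => ?_)) _
    exact (S.commute_opT_mulR _).symm.mul_left ((hT _).pow_left _)
  · have hx : ∀ i, Commute (symOp S.dx) (mulR (S.uy i)) :=
      fun i => commute_symOp_mulR (S.dx_uy i)
    have hy : ∀ i, Commute (symOp (-S.dy)) (mulR (S.ux i)) :=
      fun i => commute_symOp_mulR (by simp [S.dy_ux])
    refine .smul_left (.smul_right (.add_left (.add_right ?_ ?_) (.add_right ?_ ?_)) _) _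
    · exact hxy.pow_pow _ _
    · exact .sum_right _ _ _ fun i _ => (hxy.pow_pow _ _).mul_right ((hx _).pow_left _)
    · exact .sum_left _ _ _ fun i _ => ((hy _).pow_left _).symm.mul_left (hxy.pow_pow _ _)
    · refine .sum_left _ _ _ fun i _ => .sum_right _ _ _ fun j _ => ?_
      exact (((hy _).pow_left _).symm.mul_right (commute_mulR _ _)).mul_left
        ((hxy.pow_pow _ _).mul_right ((hx _).pow_left _))

lemma commute_nabla_heatX : Commute S.nabla S.heatX := by
  have h := S.commute_nabla_symOp S.dx_w
  unfold heatX
  refine Commute.sub_right (R := Module.End ℂ R[X][X]) S.commute_nabla_opT ?_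
  exact (.smul_right (.add_right (h.pow_right _)
    (.sum_right _ _ _ fun i _ => (S.commute_nabla_mulR _).mul_right (h.pow_right _))) _)

lemma commute_nabla_heatY : Commute S.nabla S.heatY := by
  have h := S.commute_nabla_symOp S.neg_dy_w
  unfold heatY
  refine Commute.sub_right (R := Module.End ℂ R[X][X]) S.commute_nabla_opT ?_
  exact (.smul_right (.add_right (h.pow_right _)
    (.sum_right _ _ _ fun i _ => (h.pow_right _).mul_right (S.commute_nabla_mulR _))) _)

/-! ### Degree bounds in `ξ` and cancellation of `t` -/

section Degree

variable {A : Type*} [CommRing A]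

lemma mem_degreeLT_iff_coeff {m : ℕ} {p : A[X]} :
    p ∈ degreeLT A m ↔ ∀ n, m ≤ n → p.coeff n = 0 := by
  rw [mem_degreeLT, degree_lt_iff_coeff_zero]

lemma degreeLT_le {m n : ℕ} (h : m ≤ n) {p : A[X]} (hp : p ∈ degreeLT A m) :
    p ∈ degreeLT A n :=
  degreeLT_mono h hp

lemma X_pow_mul_mem_degreeLT {m : ℕ} {p : A[X]} (hp : p ∈ degreeLT A m) (n : ℕ) :
    X ^ n * p ∈ degreeLT A (m + n) := by
  rw [mem_degreeLT_iff_coeff] at hp ⊢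
  intro k hk
  rw [coeff_X_pow_mul', if_pos (by omega)]
  exact hp _ (by omega)

lemma C_mul_mem_degreeLT {m : ℕ} {p : A[X]} (hp : p ∈ degreeLT A m) (a : A) :
    C a * p ∈ degreeLT A m := by
  rw [← smul_eq_C_mul]
  exact (degreeLT A m).smul_mem a hp

lemma natCast_mul_mem_degreeLT {m : ℕ} {p : A[X]} (hp : p ∈ degreeLT A m) (k : ℕ) :
    (k : A[X]) * p ∈ degreeLT A m := by
  rw [← nsmul_eq_mul]
  exact (degreeLT A m).nsmul_mem hp k

lemma smul_mem_degreeLT [Algebra ℂ A] {m : ℕ} {p : A[X]} (hp : p ∈ degreeLT A m) (a : ℂ) :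
    a • p ∈ degreeLT A m := by
  rw [mem_degreeLT_iff_coeff] at hp ⊢
  intro n hn
  rw [coeff_smul, hp n hn, smul_zero]

lemma coeffDer_mem_degreeLT [Algebra ℂ A] (d : Derivation ℂ A A) {m : ℕ} {p : A[X]}
    (hp : p ∈ degreeLT A m) : coeffDer d p ∈ degreeLT A m := by
  rw [mem_degreeLT_iff_coeff] at hp ⊢
  intro n hn
  rw [coeff_coeffDer, hp n hn, map_zero]

lemma X_mul_eq_zero {a : A[X]} (h : X * a = 0) : a = 0 := by
  ext n
  simpa using congrArg (fun p => p.coeff (n + 1)) h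

lemma CX_mul_eq_zero {p : A[X][X]} (h : C X * p = 0) : p = 0 := by
  ext1 n
  have := congrArg (fun p => p.coeff n) h
  rw [coeff_zero]
  exact X_mul_eq_zero (by simpa using this)

lemma CX_pow_mul_cancel {k : ℕ} {p q : A[X][X]} (h : C X ^ k * p = C X ^ k * q) : p = q := by
  induction k with
  | zero => simpa using h
  | succ k ih =>
    refine ih (sub_eq_zero.1 (CX_mul_eq_zero ?_))
    rw [mul_sub, ← mul_assoc, ← mul_assoc, ← pow_succ', h, sub_self]

lemma CX_pow_mul_mem {k m : ℕ} {q : A[X][X]} (h : C X ^ k * q ∈ degreeLT A[X] m) :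
    q ∈ degreeLT A[X] m := by
  rw [mem_degreeLT_iff_coeff] at h ⊢
  intro n hn
  have h1 := h n hn
  rw [← C_pow, coeff_C_mul] at h1
  ext i
  simpa [coeff_X_pow_mul] using congrArg (fun p => p.coeff (i + k)) h1

end Degree

/-! ### Leading terms -/

lemma symOp_mem (d : Derivation ℂ R R) {m : ℕ} {p : R[X][X]} (hp : p ∈ degreeLT R[X] m) :
    symOp d p ∈ degreeLT R[X] (m + 1) := by
  rw [symOp_apply]
  refine Submodule.add_mem _ (degreeLT_le (by omega) (coeffDer_mem_degreeLT _ hp)) ?_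
  simpa using X_pow_mul_mem_degreeLT hp 1

lemma symOp_pow_mem (d : Derivation ℂ R R) {m : ℕ} {p : R[X][X]} (hp : p ∈ degreeLT R[X] m)
    (n : ℕ) : (symOp d ^ n) p ∈ degreeLT R[X] (m + n) := by
  induction n with
  | zero => simpa using hp
  | succ n ih =>
    rw [pow_succ', Module.End.mul_apply]
    exact symOp_mem d ih

lemma symOp_pow_one (d : Derivation ℂ R R) (n : ℕ) : (symOp d ^ n) 1 = X ^ n := by
  induction n with
  | zero => simp
  | succ n ih =>
    rw [pow_succ', Module.End.mul_apply, ih, symOp_apply, Derivation.leibniz_pow, coeffDer_X,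
      smul_zero, smul_zero, zero_add, pow_succ']

/-- These are the first two terms of the binomial expansion of `(ξ + d)^{n+1}`: `d` and `ξ` commute,
and each further `d` costs one power of `ξ`. -/
lemma symOp_pow_sub_mem (d : Derivation ℂ R R) {J : ℕ} {p : R[X][X]}
    (hp : p ∈ degreeLT R[X] (J + 1)) (n : ℕ) :
    (symOp d ^ (n + 1)) p - X ^ (n + 1) * p
      - ((n + 1 : ℕ) : R[X][X]) * (X ^ n * coeffDer (coeffDer d) p) ∈ degreeLT R[X] (J + n) := by
  induction n with
  | zero =>
    have : (symOp d ^ (0 + 1)) p - X ^ (0 + 1) * p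
      - ((0 + 1 : ℕ) : R[X][X]) * (X ^ 0 * coeffDer (coeffDer d) p) = 0 := by
      simp [symOp_apply]
    rw [this]
    exact Submodule.zero_mem _
  | succ n ih =>
    set D := coeffDer (coeffDer d) with hD
    set r := (symOp d ^ (n + 1)) p - X ^ (n + 1) * p
      - ((n + 1 : ℕ) : R[X][X]) * (X ^ n * D p) with hr
    have h1 : (symOp d ^ (n + 1)) p
        = r + X ^ (n + 1) * p + ((n + 1 : ℕ) : R[X][X]) * (X ^ n * D p) := by rw [hr]; ring
    have h2 : (symOp d ^ (n + 1 + 1)) p - X ^ (n + 1 + 1) * p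
        - ((n + 1 + 1 : ℕ) : R[X][X]) * (X ^ (n + 1) * D p)
        = symOp d r + ((n + 1 : ℕ) : R[X][X]) * (X ^ n * D (D p)) := by
      rw [pow_succ' (symOp d), Module.End.mul_apply, h1, map_add, map_add, symOp_apply d (_ * p),
        symOp_apply d (_ * _), ← hD]
      simp only [Derivation.leibniz, Derivation.leibniz_pow, hD, coeffDer_X, smul_zero, add_zero,
        Derivation.map_natCast, smul_eq_mul, mul_zero]
      push_cast
      ring
    rw [h2]
    refine Submodule.add_mem _ (symOp_mem d ih) (natCast_mul_mem_degreeLT ?_ _)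
    exact degreeLT_le (by omega) (X_pow_mul_mem_degreeLT
      (coeffDer_mem_degreeLT _ (coeffDer_mem_degreeLT _ hp)) n)

lemma nκ_ne : (S.N * S.κ : ℂ) ≠ 0 :=
  mul_ne_zero (Nat.cast_ne_zero.2 (by have := S.two_le; omega)) S.κ_ne

lemma N_eq : S.N = S.N - 1 + 1 := by have := S.two_le; omega

/-- The properties of `∂_t - κ L_x` and `∂_t - κ L^*_y` on symbols which determine the transport
equations; `d` is `∂_x` or `-∂_y`. -/
structure IsHeatOp (d : Derivation ℂ R R) (P : Module.End ℂ R[X][X]) : Prop where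
  lead : ∀ (J : ℕ) (p : R[X][X]), p ∈ degreeLT R[X] (J + 1) →
    P p + (S.N * S.κ) • (X ^ (S.N - 1) * coeffDer (coeffDer d) p) ∈ degreeLT R[X] (J + (S.N - 1))
  mul_t : ∀ p, P (C X * p) = p + C X * P p
  comm : Commute S.nabla P

lemma opT_mul_t (p : R[X][X]) : S.opT (C X * p) = p + C X * S.opT p := by
  simp only [opT_apply, Derivation.leibniz, coeffDer_C, polyDer_apply, derivative_X, map_one,
    smul_eq_mul]
  ring

lemma symOp_mul_t (d : Derivation ℂ R R) (p : R[X][X]) :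
    symOp d (C X * p) = C X * symOp d p := by
  simp only [symOp_apply, Derivation.leibniz, coeffDer_C, coeffDer_X, map_zero,
    smul_eq_mul]
  ring

lemma symOp_pow_mul_t (d : Derivation ℂ R R) (n : ℕ) (p : R[X][X]) :
    (symOp d ^ n) (C X * p) = C X * (symOp d ^ n) p := by
  induction n with
  | zero => simp
  | succ n ih => rw [pow_succ', Module.End.mul_apply, ih, symOp_mul_t, Module.End.mul_apply]

/-- The `κ ξ^N` of `∂_t` cancels that of `κ (ξ + d)^N`. As there is no term of order `N - 1`, what
leads is `-Nκ ξ^{N-1} d`, without a term of order zero in `d`. -/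
lemma isHeatOp_of_lower (d : Derivation ℂ R R) (Q : Module.End ℂ R[X][X])
    (hQ : ∀ m p, p ∈ degreeLT R[X] m → Q p ∈ degreeLT R[X] (m + (S.N - 2)))
    (ht : ∀ p, Q (C X * p) = C X * Q p)
    (hc : Commute S.nabla (S.opT - S.κ • (symOp d ^ S.N + Q))) :
    S.IsHeatOp d (S.opT - S.κ • (symOp d ^ S.N + Q)) where
  lead J p hp := by
    have hN := S.two_le
    have h1 := symOp_pow_sub_mem d hp (S.N - 1)
    rw [← S.N_eq] at h1
    have h2 : (S.opT - S.κ • (symOp d ^ S.N + Q)) p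
        + (S.N * S.κ) • (X ^ (S.N - 1) * coeffDer (coeffDer d) p)
        = coeffDer polyDer p - S.κ • ((symOp d ^ S.N) p - X ^ S.N * p
          - (S.N : R[X][X]) * (X ^ (S.N - 1) * coeffDer (coeffDer d) p)) - S.κ • Q p := by
      simp only [LinearMap.sub_apply, LinearMap.smul_apply, LinearMap.add_apply, opT_apply]
      simp only [Algebra.smul_def, map_mul, map_natCast]
      ring
    rw [h2]
    refine Submodule.sub_mem _ (Submodule.sub_mem _ ?_ (smul_mem_degreeLT h1 _))
      (smul_mem_degreeLT (degreeLT_le (by omega) (hQ _ _ hp)) _)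
    exact degreeLT_le (by omega) (coeffDer_mem_degreeLT _ hp)
  mul_t p := by
    simp only [LinearMap.sub_apply, LinearMap.smul_apply, LinearMap.add_apply, opT_mul_t,
      symOp_pow_mul_t, ht]
    simp only [Algebra.smul_def]
    ring
  comm := hc

lemma isHeatOp_heatX : S.IsHeatOp S.dx S.heatX := by
  refine S.isHeatOp_of_lower _ _ (fun m p hp => ?_) (fun p => ?_) S.commute_nabla_heatX
  · rw [LinearMap.sum_apply]
    refine Submodule.sum_mem _ fun i hi => ?_
    have := Finset.mem_range.1 hi
    exact C_mul_mem_degreeLT (degreeLT_le (by omega) (symOp_pow_mem _ hp i)) _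
  · rw [LinearMap.sum_apply, LinearMap.sum_apply, Finset.mul_sum]
    refine Finset.sum_congr rfl fun i _ => ?_
    rw [Module.End.mul_apply, symOp_pow_mul_t, Module.End.mul_apply, mulR_apply, mulR_apply]
    ring

lemma isHeatOp_heatY : S.IsHeatOp (-S.dy) S.heatY := by
  refine S.isHeatOp_of_lower _ _ (fun m p hp => ?_) (fun p => ?_) S.commute_nabla_heatY
  · rw [LinearMap.sum_apply]
    refine Submodule.sum_mem _ fun i hi => ?_
    have := Finset.mem_range.1 hi
    exact degreeLT_le (by omega) (symOp_pow_mem _ (C_mul_mem_degreeLT hp (C (S.uy i))) i)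
  · rw [LinearMap.sum_apply, LinearMap.sum_apply, Finset.mul_sum]
    refine Finset.sum_congr rfl fun i _ => ?_
    rw [Module.End.mul_apply, mulR_apply, mul_left_comm, symOp_pow_mul_t, Module.End.mul_apply,
      mulR_apply]

/-! ### Reduction to degree less than `N - 1` -/

/-- Multiplication by `t`, followed by the reduction of powers `ξ ^ n` with `n ≥ N - 1` modulo the
image of `nabla`. -/
def red : Module.End ℂ R[X][X] :=
  LinearMap.mulLeft ℂ (C X) -
    (S.N * S.κ)⁻¹ • (S.nabla * (shiftDown (S.N - 1)).restrictScalars ℂ)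

lemma red_apply (p : R[X][X]) :
    S.red p = C X * p - (S.N * S.κ)⁻¹ • S.nabla (shiftDown (S.N - 1) p) := rfl

lemma coeff_nabla (p : R[X][X]) (n : ℕ) : (S.nabla p).coeff n =
    p.coeff (n + 1) * (n + 1) + C S.w * p.coeff n +
      if S.N - 1 ≤ n then (S.N * S.κ) • (X * p.coeff (n - (S.N - 1))) else 0 := by
  rw [nabla_apply, add_mul, smul_mul_assoc, mul_assoc, coeff_add, coeff_add, coeff_derivative,
    coeff_C_mul, coeff_smul, coeff_C_mul, coeff_X_pow_mul', add_assoc]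
  split_ifs <;> simp

/-- Below degree `2(N - 1)` one division by `ξ^{N-1}` is enough: the quotient has degree `< N - 1`,
so the terms `∂_ξ + w` of `∇` create no new high powers. -/
lemma red_mem {p : R[X][X]} (hp : p ∈ degreeLT R[X] (2 * (S.N - 1))) :
    S.red p ∈ degreeLT R[X] (S.N - 1) := by
  rw [mem_degreeLT_iff_coeff] at hp ⊢
  intro n hn
  have h1 : p.coeff (n + 1 + (S.N - 1)) = 0 := hp _ (by omega)
  have h2 : p.coeff (n + (S.N - 1)) = 0 := hp _ (by omega)
  rw [red_apply, coeff_sub, coeff_C_mul, coeff_smul, coeff_nabla, if_pos hn, coeff_shiftDown,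
    coeff_shiftDown, coeff_shiftDown, h1, h2, Nat.sub_add_cancel hn, zero_mul, mul_zero, zero_add,
    zero_add, inv_smul_smul₀ S.nκ_ne, sub_self]

lemma red_of_mem {p : R[X][X]} (hp : p ∈ degreeLT R[X] (S.N - 1)) : S.red p = C X * p := by
  rw [mem_degreeLT_iff_coeff] at hp
  have : shiftDown (S.N - 1) p = 0 := by
    ext1 n
    rw [coeff_shiftDown, hp _ (by omega), coeff_zero]
  rw [red_apply, this, map_zero, smul_zero, sub_zero]

lemma nabla_mul_t (p : R[X][X]) : S.nabla (C X * p) = C X * S.nabla p := by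
  rw [nabla_apply, nabla_apply, derivative_C_mul]
  ring

lemma red_mul_t (p : R[X][X]) : S.red (C X * p) = C X * S.red p := by
  have h : shiftDown (S.N - 1) (C X * p) = C X * shiftDown (S.N - 1) p := by
    rw [← smul_eq_C_mul, map_smul, smul_eq_C_mul]
  rw [red_apply, red_apply, h, nabla_mul_t, mul_sub, mul_smul_comm]

lemma red_sub_mem_range (p : R[X][X]) : ∃ q, C X * p = S.red p + S.nabla q :=
  ⟨(S.N * S.κ)⁻¹ • shiftDown (S.N - 1) p, by rw [red_apply, map_smul]; ring⟩

/-- The leading coefficient of `∇ q` is `Nκ t` times that of `q`, in degree higher by `N - 1`. This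
makes reduced symbols unique modulo `∇`. -/
lemma eq_zero_of_nabla_mem {q : R[X][X]} (h : S.nabla q ∈ degreeLT R[X] (S.N - 1)) : q = 0 := by
  by_contra hq
  rw [mem_degreeLT_iff_coeff] at h
  have hN := S.two_le
  have h1 := h (q.natDegree + (S.N - 1)) (by omega)
  rw [coeff_nabla, if_pos (by omega), coeff_eq_zero_of_natDegree_lt (by omega),
    coeff_eq_zero_of_natDegree_lt (by omega), Nat.add_sub_cancel, zero_mul, mul_zero, zero_add,
    zero_add, smul_eq_zero_iff_right S.nκ_ne] at h1
  exact hq (leadingCoeff_eq_zero.1 (X_mul_eq_zero h1))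

namespace IsHeatOp

variable {S} {d : Derivation ℂ R R} {P : Module.End ℂ R[X][X]} (hP : S.IsHeatOp d P)

include hP

lemma apply_mem {p : R[X][X]} (hp : p ∈ degreeLT R[X] (S.N - 1)) :
    P p ∈ degreeLT R[X] (2 * (S.N - 1)) := by
  have hN := S.two_le
  have h := hP.lead (S.N - 2) p (degreeLT_le (by omega) hp)
  rw [← sub_neg_eq_add] at h
  refine (Submodule.sub_mem_iff_left _ (Submodule.neg_mem _ (smul_mem_degreeLT ?_ _))).1
    (degreeLT_le (by omega) h)
  exact degreeLT_le (by omega) (X_pow_mul_mem_degreeLT (coeffDer_mem_degreeLT _ hp) _)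

lemma red_apply_mem {p : R[X][X]} (hp : p ∈ degreeLT R[X] (S.N - 1)) :
    S.red (P p) ∈ degreeLT R[X] (S.N - 1) :=
  S.red_mem (hP.apply_mem hp)

lemma red_mul_t {p : R[X][X]} (hp : p ∈ degreeLT R[X] (S.N - 1)) :
    S.red (P (C X * p)) = C X * p + C X * S.red (P p) := by
  rw [hP.mul_t, map_add, S.red_of_mem hp, S.red_mul_t]

/-- Moving `∂_t` past `t^k` produces the constant `k` of the transport equation. -/
lemma red_mul_t_pow {p : R[X][X]} (hp : p ∈ degreeLT R[X] (S.N - 1)) (k : ℕ) :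
    S.red (P (C X ^ k * p)) = C X ^ k * ((k : R[X][X]) * p + S.red (P p)) := by
  induction k with
  | zero => simp
  | succ k ih =>
    have h : C X ^ k * p ∈ degreeLT R[X] (S.N - 1) := by
      rw [← C_pow]; exact C_mul_mem_degreeLT hp _
    rw [pow_succ', mul_assoc, hP.red_mul_t h, ih]
    push_cast
    ring

/-- The top term of `P p` is `-Nκ (d p_J) ξ^{J+N-1}`, and reduction replaces `Nκ t ξ^{J+N-1}` by `-w
ξ^J` plus lower powers. So at `t = 0` the top coefficient is acted on by `w d`. -/
lemma coeff_red_apply {J : ℕ} (hJ : J < S.N - 1) {p : R[X][X]}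
    (hp : p ∈ degreeLT R[X] (J + 1)) :
    X ∣ (S.red (P p)).coeff J - C S.w * coeffDer d (p.coeff J) := by
  have h := hP.lead J p hp
  rw [mem_degreeLT_iff_coeff] at h hp
  have h1 := h (J + (S.N - 1)) le_rfl
  have h2 := h (J + 1 + (S.N - 1)) (by omega)
  rw [coeff_add, coeff_smul, coeff_X_pow_mul, coeff_coeffDer] at h1 h2
  rw [hp (J + 1) le_rfl, map_zero, smul_zero, add_zero] at h2
  rw [S.red_apply, coeff_sub, coeff_C_mul, coeff_smul, coeff_nabla, if_neg (by omega),
    coeff_shiftDown, coeff_shiftDown, h2, zero_mul, zero_add, add_zero,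
    eq_neg_of_add_eq_zero_left h1, mul_neg, smul_neg, mul_smul_comm, inv_smul_smul₀ S.nκ_ne]
  exact ⟨(P p).coeff J, by ring⟩

/-- The part above degree `J` is of the form `t q₂`, and `red (P (t q₂)) = t (q₂ + red (P q₂))` is
invisible at `t = 0`. -/
lemma coeff_red_apply_of_dvd {J : ℕ} (hJ : J < S.N - 1) {q : R[X][X]}
    (hq : q ∈ degreeLT R[X] (S.N - 1)) (h : ∀ l, J < l → X ∣ q.coeff l) :
    X ∣ (S.red (P q)).coeff J - C S.w * coeffDer d (q.coeff J) := by
  set q₁ : R[X][X] := ∑ l ∈ Finset.range (J + 1), monomial l (q.coeff l) with hq₁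
  have hc : ∀ n, q₁.coeff n = if n < J + 1 then q.coeff n else 0 := by
    intro n
    rw [hq₁, finsetSum_coeff]
    simp [coeff_monomial]
  have hmem : q₁ ∈ degreeLT R[X] (J + 1) := by
    rw [mem_degreeLT_iff_coeff]
    intro n hn
    rw [hc, if_neg (by omega)]
  obtain ⟨q₂, hq₂⟩ : C X ∣ q - q₁ := by
    rw [C_dvd_iff_dvd_coeff]
    intro n
    rw [coeff_sub, hc]
    split_ifs with hn
    · simp
    · simpa using h n (by omega)
  have hq₂m : q₂ ∈ degreeLT R[X] (S.N - 1) := by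
    refine CX_pow_mul_mem (k := 1) ?_
    rw [pow_one, ← hq₂]
    exact Submodule.sub_mem _ hq (degreeLT_le (by omega) hmem)
  have h1 := hP.coeff_red_apply hJ hmem
  rw [hc, if_pos (by omega)] at h1
  have h2 : S.red (P q) = S.red (P q₁) + C X * (q₂ + S.red (P q₂)) := by
    rw [eq_add_of_sub_eq hq₂, map_add, map_add, hP.red_mul_t hq₂m]
    ring
  rw [h2, coeff_add, coeff_C_mul, add_sub_right_comm]
  exact dvd_add h1 (dvd_mul_right _ _)

/-- To show that a symbol is divisible by `t`, look at the highest coefficient which is not. -/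
lemma dvd_of_lead {q : R[X][X]} (hq : q ∈ degreeLT R[X] (S.N - 1))
    (h : ∀ J < S.N - 1, (∀ l, J < l → X ∣ q.coeff l) →
      X ∣ (S.red (P q)).coeff J - C S.w * coeffDer d (q.coeff J) → X ∣ q.coeff J) :
    C X ∣ q := by
  rw [C_dvd_iff_dvd_coeff]
  by_contra hne
  have h0 : q.map constantCoeff ≠ 0 := by
    intro h0
    refine hne fun n => X_dvd_iff.2 ?_
    simpa using congrArg (fun p => p.coeff n) h0
  set J := (q.map constantCoeff).natDegree with hJ
  have hJn : ¬ X ∣ q.coeff J := by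
    rw [X_dvd_iff]
    have := leadingCoeff_ne_zero.2 h0
    simpa [leadingCoeff, ← hJ] using this
  have hJl : ∀ l, J < l → X ∣ q.coeff l := by
    intro l hl
    rw [X_dvd_iff]
    simpa using coeff_eq_zero_of_natDegree_lt hl
  have hJN : J < S.N - 1 := by
    by_contra hlt
    rw [mem_degreeLT_iff_coeff] at hq
    exact hJn (by rw [hq J (by omega)]; exact dvd_zero _)
  exact hJn (h J hJN hJl (hP.coeff_red_apply_of_dvd hJN hq hJl))

/-- At `t = 0` the highest surviving coefficient `c` satisfies `m c + w d c = 0`, hence vanishes. -/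
lemma dvd_of_transport
    (hd : ∀ (k : ℕ) (c : R), 1 ≤ k → (k : R) * c + S.w * d c = 0 → c = 0)
    {m : ℕ} (hm : 1 ≤ m) {q : R[X][X]} (hq : q ∈ degreeLT R[X] (S.N - 1))
    (h : C X ∣ (m : R[X][X]) * q + S.red (P q)) : C X ∣ q := by
  refine hP.dvd_of_lead hq fun J _ _ h1 => ?_
  rw [C_dvd_iff_dvd_coeff] at h
  have h2 := h J
  rw [X_dvd_iff] at h1 h2 ⊢
  refine hd m _ hm ?_
  rw [coeff_sub, coeff_C_mul, coeff_coeffDer, sub_eq_zero] at h1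
  rw [coeff_add, coeff_add, h1, ← nsmul_eq_mul, coeff_smul, coeff_smul, nsmul_eq_mul] at h2
  exact h2

/-- If `Z = t^{m+1} q`, dividing the equation by `t^{m+1}` leaves `(m + 1 - s) q + red (P q) ≡ 0`
modulo `t`, with a positive constant as long as `m ≥ s`. The case `s = 0` serves the difference of
two solutions, `s = 1` the defect of one. -/
lemma pow_dvd_of_transport
    (hd : ∀ (k : ℕ) (c : R), 1 ≤ k → (k : R) * c + S.w * d c = 0 → c = 0)
    {s K : ℕ} {Z : R[X][X]} (hZ : Z ∈ degreeLT R[X] (S.N - 1))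
    (h0 : C X ^ (s + 1) ∣ Z) (h : C X ^ (K + 1) ∣ S.red (P Z) - (s : R[X][X]) * Z) :
    C X ^ (K + 1) ∣ Z := by
  have key : ∀ m, m ≤ K → s ≤ m → C X ^ (m + 1) ∣ Z := by
    intro m hm hs
    induction m, hs using Nat.le_induction with
    | base => exact h0
    | succ m hs ih =>
      obtain ⟨q, rfl⟩ := ih (by omega)
      have hq := CX_pow_mul_mem hZ
      rw [pow_succ _ (m + 1)]
      refine mul_dvd_mul_left _
        (hP.dvd_of_transport hd (m := m + 1 - s) (by omega) hq ?_)
      rw [hP.red_mul_t_pow hq] at h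
      obtain ⟨r, hr⟩ := h
      refine ⟨C X ^ (K - m - 1) * r, CX_pow_mul_cancel (k := m + 1) ?_⟩
      rw [show K + 1 = (m + 1) + 1 + (K - m - 1) by omega] at hr
      rw [Nat.cast_sub (by omega)]
      linear_combination hr
  rcases le_total s K with hsK | hsK
  · exact key K le_rfl hsK
  · exact (pow_dvd_pow _ (by omega)).trans h0

end IsHeatOp

/-- The reduced operators inherit commutativity, up to the terms due to the factor `t`. -/
lemma red_heat_comm {p : R[X][X]} (hp : p ∈ degreeLT R[X] (S.N - 1)) :
    S.red (S.heatY (S.red (S.heatX p))) - S.red (S.heatX p) =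
      S.red (S.heatX (S.red (S.heatY p))) - S.red (S.heatY p) := by
  have hX := S.isHeatOp_heatX
  have hY := S.isHeatOp_heatY
  have key : ∀ {d d' P P'}, S.IsHeatOp d P → S.IsHeatOp d' P' → ∃ q,
      S.red (P' (S.red (P p))) - S.red (P p) = C X * (C X * P' (P p)) + S.nabla q := by
    intro d d' P P' h h'
    obtain ⟨a, ha⟩ := S.red_sub_mem_range (P p)
    obtain ⟨b, hb⟩ := S.red_sub_mem_range (P' (S.red (P p)))
    have h1 : P' (S.red (P p)) = P p + C X * P' (P p) - S.nabla (P' a) := by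
      rw [eq_sub_of_add_eq ha.symm, map_sub, h'.mul_t]
      congr 1
      exact (LinearMap.congr_fun h'.comm.eq a).symm
    refine ⟨a - C X * P' a - b, ?_⟩
    rw [eq_sub_of_add_eq hb.symm, h1, map_sub, map_sub, nabla_mul_t]
    linear_combination ha
  obtain ⟨a, ha⟩ := key hX hY
  obtain ⟨b, hb⟩ := key hY hX
  have hc : S.heatX (S.heatY p) = S.heatY (S.heatX p) :=
    LinearMap.congr_fun S.commute_heatX_heatY.eq p
  -- Both sides are reduced and have the same part `t² P_x P_y p`, so they differ by `∇ (a - b)` of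
  -- degree `< N - 1`.
  have hab : a - b = 0 := by
    refine S.eq_zero_of_nabla_mem ?_
    have : S.nabla (a - b) = S.red (S.heatY (S.red (S.heatX p))) - S.red (S.heatX p) -
      (S.red (S.heatX (S.red (S.heatY p))) - S.red (S.heatY p)) := by
      rw [ha, hb, hc, map_sub]; ring
    rw [this]
    exact Submodule.sub_mem _
      (Submodule.sub_mem _ (hY.red_apply_mem (hX.red_apply_mem hp)) (hX.red_apply_mem hp))
      (Submodule.sub_mem _ (hX.red_apply_mem (hY.red_apply_mem hp)) (hY.red_apply_mem hp))
  rw [ha, hb, hc, sub_eq_zero.1 hab]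

/-! ### Action on test functions at the diagonal -/

/-- `∂_y` on polynomials in `t`. -/
abbrev dyt : Derivation ℂ R[X] R[X] := coeffDer S.dy

/-- The symbol `∑ c_l ξ ^ l`, integrated against a test function `f` of `y` as `t → 0`: on the
diagonal this is `∑ ∂_y ^ l (c_l f)`. -/
def pair (f : R[X]) : R[X][X] →ₗ[ℂ] R[X] where
  toFun p := p.sum fun l c => S.dyt^[l] (c * f)
  map_add' p q := sum_add_index p q _ (by simp) fun l a b => by rw [add_mul, iterate_map_add]
  map_smul' r p := by
    rw [sum_smul_index' _ _ _ (by simp)]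
    simp only [RingHom.id_apply, Polynomial.sum, Finset.smul_sum, smul_mul_assoc]
    refine Finset.sum_congr rfl fun l hl => ?_
    clear hl
    generalize p.coeff l * f = g
    induction l generalizing g with
    | zero => rfl
    | succ l ih => rw [Function.iterate_succ_apply, Derivation.map_smul, ih,
        Function.iterate_succ_apply]

lemma pair_monomial (f : R[X]) (l : ℕ) (c : R[X]) :
    S.pair f (monomial l c) = S.dyt^[l] (c * f) :=
  sum_monomial_index c (fun l c => S.dyt^[l] (c * f)) (by simp)

lemma dyt_iterate_t_mul (l : ℕ) (g : R[X]) : S.dyt^[l] (X * g) = X * S.dyt^[l] g := by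
  induction l generalizing g with
  | zero => rfl
  | succ l ih =>
    rw [Function.iterate_succ_apply, Function.iterate_succ_apply, ← ih]
    simp [Derivation.leibniz]

lemma dyt_iterate_w_mul (l : ℕ) (g : R[X]) :
    S.dyt^[l] (C S.w * g) = C S.w * S.dyt^[l] g - l * S.dyt^[l - 1] g := by
  induction l generalizing g with
  | zero => simp
  | succ l ih =>
    have h : S.dyt (C S.w * g) = C S.w * S.dyt g - g := by
      simp only [Derivation.leibniz, coeffDer_C, S.dy_w, smul_eq_mul, map_neg, map_one]
      ring
    rw [Function.iterate_succ_apply, h, iterate_map_sub, ih, Function.iterate_succ_apply,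
      Nat.add_sub_cancel]
    rcases l with _ | l
    · simp
    · rw [Nat.add_sub_cancel, Function.iterate_succ_apply _ l g]
      push_cast
      ring

lemma pair_t_mul (f : R[X]) (p : R[X][X]) : S.pair f (C X * p) = X * S.pair f p := by
  induction p using Polynomial.induction_on' with
  | add p q hp hq => rw [mul_add, map_add, map_add, hp, hq, mul_add]
  | monomial l c => rw [C_mul_monomial, pair_monomial, pair_monomial, mul_assoc, dyt_iterate_t_mul]

/-- Since `∂_y w = -1`, `∂_y^l (w g) = w ∂_y^l g - l ∂_y^{l-1} g`, and the last term cancels the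
contribution of `∂_ξ`. -/
lemma pair_derivative_add (f : R[X]) (p : R[X][X]) :
    S.pair f (derivative p + C (C S.w) * p) = C S.w * S.pair f p := by
  induction p using Polynomial.induction_on' with
  | add p q hp hq =>
    rw [derivative_add, mul_add, add_add_add_comm, map_add, hp, hq, map_add, mul_add]
  | monomial l c =>
    rw [derivative_monomial, C_mul_monomial, map_add, pair_monomial, pair_monomial, pair_monomial,
      mul_assoc (C S.w), dyt_iterate_w_mul]
    have : S.dyt^[l - 1] (c * l * f) = l * S.dyt^[l - 1] (c * f) := by
      rw [← nsmul_eq_mul, ← iterate_map_nsmul, nsmul_eq_mul]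
      ring_nf
    rw [this]
    ring

/-- Integration by parts against the test function, here `∂_y^{l+1}(c f) - ∂_y^l((∂_y c) f) =
∂_y^l(c ∂_y f)`. -/
lemma pair_symOp (f : R[X]) (p : R[X][X]) :
    S.pair f (symOp (-S.dy) p) = S.pair (S.dyt f) p := by
  induction p using Polynomial.induction_on' with
  | add p q hp hq => rw [map_add, map_add, map_add, hp, hq]
  | monomial l c =>
    have h : coeffDer (-S.dy) c = - S.dyt c := by ext n; simp
    rw [symOp_apply, coeffDer_monomial, h, X_mul_monomial, map_add, pair_monomial, pair_monomial,
      pair_monomial, Function.iterate_succ_apply, ← iterate_map_add]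
    congr 1
    simp only [Derivation.leibniz, smul_eq_mul]
    ring

lemma pair_symOp_pow (f : R[X]) (n : ℕ) (p : R[X][X]) :
    S.pair f ((symOp (-S.dy) ^ n) p) = S.pair (S.dyt^[n] f) p := by
  induction n generalizing f with
  | zero => rfl
  | succ n ih =>
    rw [pow_succ', Module.End.mul_apply, pair_symOp, ih, Function.iterate_succ_apply]

/-- The polynomials in `t` whose value at `t = 0` vanishes on the diagonal. -/
def diagt : Ideal R[X] := S.diag.comap constantCoeff

lemma mem_diagt {b : R[X]} : b ∈ S.diagt ↔ b.coeff 0 ∈ S.diag := Iff.rfl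

lemma t_mul_mem (b : R[X]) : X * b ∈ S.diagt := by simp [mem_diagt]

lemma w_mul_mem (b : R[X]) : C S.w * b ∈ S.diagt :=
  S.diagt.mul_mem_right _ (by simpa [mem_diagt] using S.w_mem)

lemma smul_mem_diagt {b : R[X]} (hb : b ∈ S.diagt) (c : ℂ) : c • b ∈ S.diagt := by
  rw [Algebra.smul_def]
  exact S.diagt.mul_mem_left _ hb

/-- Up to a multiple of `t`, `red p` is a scalar times `(∂_ξ + w) q`, which pairs to a multiple of
`w`. -/
lemma pair_red_mem (f : R[X]) (p : R[X][X]) : S.pair f (S.red p) ∈ S.diagt := by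
  set q := shiftDown (S.N - 1) p with hq
  have h : S.red p = C X * (p - X ^ (S.N - 1) * q)
      - (S.N * S.κ)⁻¹ • (derivative q + C (C S.w) * q) := by
    rw [red_apply, nabla_apply, add_mul, ← add_assoc, smul_add, smul_mul_assoc,
      inv_smul_smul₀ S.nκ_ne]
    ring
  rw [h, map_sub, map_smul, pair_t_mul, pair_derivative_add]
  exact S.diagt.sub_mem (S.t_mul_mem _) (S.smul_mem_diagt (S.w_mul_mem _) _)

lemma dyt_iterate_w_pow (J : ℕ) (b : R[X]) :
    (∀ l < J, S.dyt^[l] (b * C S.w ^ J) ∈ S.diagt) ∧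
      S.dyt^[J] (b * C S.w ^ J) - (-1) ^ J * (J.factorial : R[X]) * b ∈ S.diagt := by
  induction J with
  | zero => simp
  | succ J ih =>
    have h : b * C S.w ^ (J + 1) = C S.w * (b * C S.w ^ J) := by ring
    rw [h]
    refine ⟨fun l hl => ?_, ?_⟩
    · rw [dyt_iterate_w_mul]
      refine S.diagt.sub_mem (S.w_mul_mem _) ?_
      rcases l with _ | l
      · simp
      · exact S.diagt.mul_mem_left _ (ih.1 _ (by omega))
    · rw [dyt_iterate_w_mul, Nat.add_sub_cancel]
      have : ∀ a c : R[X], a - ((J + 1 : ℕ) : R[X]) * c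
          - (-1) ^ (J + 1) * ((J + 1).factorial : R[X]) * b
          = a - ((J + 1 : ℕ) : R[X]) * (c - (-1) ^ J * (J.factorial : R[X]) * b) := by
        intro a c
        rw [Nat.factorial_succ]
        push_cast
        ring
      rw [this]
      exact S.diagt.sub_mem (S.w_mul_mem _) (S.diagt.mul_mem_left _ ih.2)

/-- The test function `w^J` isolates the coefficient of `ξ^J`: terms with `l < J` vanish on the
diagonal, those with `l > J` are multiples of `t`, and `l = J` gives `(-1)^J J! q_J`. -/
lemma mem_diagt_of_pair {q : R[X][X]} {J : ℕ} (hl : ∀ l, J < l → X ∣ q.coeff l)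
    (h : ∀ f, S.pair f q ∈ S.diagt) : q.coeff J ∈ S.diagt := by
  have h1 := h (C S.w ^ J)
  have h2 : S.pair (C S.w ^ J) q =
      ∑ l ∈ Finset.range (q.natDegree + J + 1), S.dyt^[l] (q.coeff l * C S.w ^ J) :=
    sum_over_range' q (f := fun l c => S.dyt^[l] (c * C S.w ^ J)) (by simp) _ (by omega)
  rw [h2, ← Finset.add_sum_erase _ _ (Finset.mem_range.2 (show J < _ by omega))] at h1
  have h3 : ∑ l ∈ (Finset.range (q.natDegree + J + 1)).erase J,
      S.dyt^[l] (q.coeff l * C S.w ^ J) ∈ S.diagt := by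
    refine S.diagt.sum_mem fun l hmem => ?_
    rcases lt_or_gt_of_ne (Finset.ne_of_mem_erase hmem) with hlt | hgt
    · exact (S.dyt_iterate_w_pow J _).1 l hlt
    · obtain ⟨c, hc⟩ := hl l hgt
      rw [hc, mul_assoc, dyt_iterate_t_mul]
      exact S.t_mul_mem _
  have h4 := (S.diagt.add_mem_iff_left h3).1 h1
  have h5 := (S.diagt.sub_mem h4 (S.dyt_iterate_w_pow J (q.coeff J)).2)
  rw [sub_sub_cancel] at h5
  have h6 : q.coeff J = (((-1) ^ J * (J.factorial : ℂ))⁻¹) •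
      ((-1) ^ J * (J.factorial : R[X]) * q.coeff J) := by
    have h7 : ((-1) ^ J * (J.factorial : ℂ)) ≠ 0 :=
      mul_ne_zero (pow_ne_zero _ (by norm_num)) (Nat.cast_ne_zero.2 J.factorial_ne_zero)
    rw [eq_inv_smul_iff₀ h7, Algebra.smul_def]
    simp
  rw [h6]
  exact S.smul_mem_diagt h5 _

/-- Applying `∂_x` gives the transport equation with `k = 1`. -/
lemma eq_zero_of_w_mul {c : R} (h : S.w * c = 0) : c = 0 := by
  refine S.transport_x 1 c le_rfl ?_
  have := congrArg S.dx h
  rw [Derivation.leibniz, S.dx_w, map_zero, smul_eq_mul, smul_eq_mul, mul_one] at this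
  rw [Nat.cast_one, one_mul, add_comm, this]

/-- The degenerate transport equation `w ∂_y c = 0` makes the highest coefficient constant in `y`;
the pairing makes it vanish on the diagonal. -/
lemma dvd_of_pair {q : R[X][X]} (hq : q ∈ degreeLT R[X] (S.N - 1))
    (h : C X ∣ S.red (S.heatY q)) (hpair : ∀ f, S.pair f q ∈ S.diagt) : C X ∣ q := by
  refine S.isHeatOp_heatY.dvd_of_lead hq fun J _ hJl h1 => ?_
  rw [C_dvd_iff_dvd_coeff] at h
  have h2 := h J
  rw [X_dvd_iff] at h1 h2 ⊢
  rw [coeff_sub, h2, coeff_C_mul, coeff_coeffDer, zero_sub, neg_eq_zero] at h1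
  refine S.eq_zero_of_dy _ (S.mem_diagt_of_pair hJl hpair) ?_
  simpa using S.eq_zero_of_w_mul h1

/-! ### Uniqueness and symmetry -/

lemma heat_sub_one : (S.heatX - S.heatY) 1 = S.κ • ∑ i ∈ Finset.range (S.N - 1),
    ((symOp (-S.dy) ^ i) (C (C (S.uy i))) - monomial i (C (S.ux i))) := by
  simp only [heatX, heatY, LinearMap.sub_apply, LinearMap.smul_apply, LinearMap.add_apply,
    LinearMap.sum_apply, Module.End.mul_apply, symOp_pow_one, mulR_apply, mul_one,
    Finset.sum_sub_distrib, C_mul_X_pow_eq_monomial, smul_add, smul_sub]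
  abel

lemma heat_sub_one_mem : (S.heatX - S.heatY) 1 ∈ degreeLT R[X] (S.N - 1) := by
  rw [heat_sub_one]
  refine smul_mem_degreeLT (Submodule.sum_mem _ fun i hi => ?_) _
  have hi := Finset.mem_range.1 hi
  have hC : ∀ c : R[X], C c ∈ degreeLT R[X] 1 := fun c => by
    rw [mem_degreeLT_iff_coeff]
    intro n hn
    rw [coeff_C, if_neg (by omega)]
  refine Submodule.sub_mem _ (degreeLT_le (by omega) (symOp_pow_mem _ (hC _) i)) ?_
  rw [mem_degreeLT_iff_coeff]
  intro n hn
  rw [coeff_monomial, if_neg (by omega)]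

/-- The adjointness of `L` and `L^*` enters here: `(ξ - ∂_y)^i u_i(y)` pairs to `u_i(y) ∂_y^i f` and
`u_i(x) ξ^i` to `u_i(x) ∂_y^i f`, which agree on the diagonal. -/
lemma pair_heat_sub_one_mem (f : R[X]) : S.pair f ((S.heatX - S.heatY) 1) ∈ S.diagt := by
  rw [heat_sub_one, map_smul, map_sum]
  refine S.smul_mem_diagt (S.diagt.sum_mem fun i _ => ?_) _
  have h1 : ∀ (l : ℕ) (g : R[X]), S.dyt^[l] (C (S.ux i) * g) = C (S.ux i) * S.dyt^[l] g := by
    intro l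
    induction l with
    | zero => simp
    | succ l ih =>
      intro g
      rw [Function.iterate_succ_apply, Derivation.leibniz, coeffDer_C, S.dy_ux, map_zero,
        smul_zero, add_zero, smul_eq_mul, ih, Function.iterate_succ_apply]
  rw [map_sub, pair_symOp_pow, ← monomial_zero_left, pair_monomial, pair_monomial, h1,
    Function.iterate_zero_apply, ← sub_mul, ← neg_sub, ← C_sub]
  refine S.diagt.mul_mem_right _ (S.diagt.neg_mem ?_)
  simpa [mem_diagt] using S.ux_sub_uy_mem i

lemma heat_sub_mul_t (p : R[X][X]) :
    (S.heatX - S.heatY) (C X * p) = C X * (S.heatX - S.heatY) p := by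
  rw [LinearMap.sub_apply, S.isHeatOp_heatX.mul_t, S.isHeatOp_heatY.mul_t, LinearMap.sub_apply]
  ring

lemma red_heatX_eq (G₁ : R[X][X]) : S.red (S.heatX (1 + C X * G₁)) =
    S.red (S.heatY (1 + C X * G₁)) +
      C X * ((S.heatX - S.heatY) 1 + S.red ((S.heatX - S.heatY) G₁)) := by
  have e1 : S.heatX (1 + C X * G₁) = S.heatY (1 + C X * G₁) +
      ((S.heatX - S.heatY) 1 + C X * (S.heatX - S.heatY) G₁) := by
    rw [← heat_sub_mul_t, ← map_add, LinearMap.sub_apply]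
    ring
  rw [e1, map_add S.red, map_add S.red, S.red_of_mem S.heat_sub_one_mem, S.red_mul_t, mul_add]

/-- A symbol starting with `1` which solves the dual equation in `y` up to order `t ^ K` solves the
equation in `x` to first order. -/
lemma exists_red_heatX_eq {K : ℕ} (hK : 1 ≤ K) {G : R[X][X]} (hG₁ : C X ∣ G - 1)
    (h : C X ^ (K + 1) ∣ S.red (S.heatY G)) :
    ∃ q, S.red (S.heatX G) = C X * q ∧ ∀ f, S.pair f q ∈ S.diagt := by
  obtain ⟨G₁, hG₁⟩ := hG₁
  obtain rfl : G = 1 + C X * G₁ := by rw [← hG₁]; ring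
  obtain ⟨Q, hQ⟩ := h
  -- As `K ≥ 1`, the error of the `y`-equation still carries a factor `t` after division by `t`, so
  -- the pairing does not see it.
  refine ⟨C X * (C X ^ (K - 1) * Q) +
    ((S.heatX - S.heatY) 1 + S.red ((S.heatX - S.heatY) G₁)), ?_, fun f => ?_⟩
  · rw [red_heatX_eq, hQ, show K + 1 = K - 1 + 2 by omega]
    ring
  · rw [map_add, map_add, pair_t_mul]
    exact S.diagt.add_mem (S.t_mul_mem _)
      (S.diagt.add_mem (S.pair_heat_sub_one_mem f) (S.pair_red_mem _ _))

/-- A symbol starting with `1` which solves the dual equation in `y` up to order `t ^ K` solves the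
equation in `x` up to the same order. -/
theorem dvd_red_heatX {K : ℕ} (hK : 1 ≤ K) {G : R[X][X]}
    (hG : G ∈ degreeLT R[X] (S.N - 1)) (hG₁ : C X ∣ G - 1)
    (h : C X ^ (K + 1) ∣ S.red (S.heatY G)) : C X ^ (K + 1) ∣ S.red (S.heatX G) := by
  have hX := S.isHeatOp_heatX
  have hY := S.isHeatOp_heatY
  obtain ⟨q, hXq, hpair⟩ := S.exists_red_heatX_eq hK hG₁ h
  obtain ⟨Q, hQ⟩ := h
  have hD := hX.red_apply_mem hG
  have hqm : q ∈ degreeLT R[X] (S.N - 1) :=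
    CX_pow_mul_mem (k := 1) (by rw [pow_one, ← hXq]; exact hD)
  have hcomm : C X ^ (K + 1) ∣ S.red (S.heatY (S.red (S.heatX G))) - S.red (S.heatX G) := by
    have hQm : Q ∈ degreeLT R[X] (S.N - 1) :=
      CX_pow_mul_mem (by rw [← hQ]; exact hY.red_apply_mem hG)
    rw [S.red_heat_comm hG, hQ, hX.red_mul_t_pow hQm, ← mul_sub]
    exact dvd_mul_right _ _
  -- The coefficient of `t` in the defect is the one that the commutation relation alone cannot
  -- kill.
  have hqt : C X ∣ q := by
    refine S.dvd_of_pair hqm ?_ hpair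
    obtain ⟨r, hr⟩ := hcomm
    rw [hXq, hY.red_mul_t hqm, add_sub_cancel_left] at hr
    refine ⟨C X ^ (K - 1) * r, CX_pow_mul_cancel (k := 1) ?_⟩
    rw [pow_one, hr, ← mul_assoc, ← mul_assoc, ← pow_two, ← pow_add]
    congr 2
    omega
  refine hY.pow_dvd_of_transport (s := 1) (fun k c hk h => ?_) hD ?_ ?_
  · refine S.transport_y k c hk ?_
    rwa [Derivation.neg_apply, mul_neg, ← sub_eq_add_neg] at h
  · rw [hXq, pow_two]
    exact mul_dvd_mul_left _ hqt
  · rwa [Nat.cast_one, one_mul]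

/-- The solution of the equation in `x` and the solution of the dual equation in `y` agree. -/
theorem dvd_sub_of_dual {K : ℕ} (hK : 1 ≤ K) {H G : R[X][X]}
    (hH : H ∈ degreeLT R[X] (S.N - 1)) (hG : G ∈ degreeLT R[X] (S.N - 1))
    (hH₁ : C X ∣ H - 1) (hG₁ : C X ∣ G - 1) (hx : C X ^ (K + 1) ∣ S.red (S.heatX H))
    (hy : C X ^ (K + 1) ∣ S.red (S.heatY G)) : C X ^ (K + 1) ∣ H - G := by
  refine S.isHeatOp_heatX.pow_dvd_of_transport (s := 0) S.transport_x
    (Submodule.sub_mem _ hH hG) ?_ ?_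
  · rw [zero_add, pow_one, ← sub_sub_sub_cancel_right H G 1]
    exact dvd_sub hH₁ hG₁
  · rw [Nat.cast_zero, zero_mul, sub_zero, map_sub, map_sub]
    exact dvd_sub hx (S.dvd_red_heatX hK hG hG₁ hy)

end TransportAlgebra

/-! ### Airy-type integrals -/

lemma exists_bound_of_even_of_tendsto {f : ℝ → ℝ} (hf : Continuous f) (he : ∀ s, f (-s) = f s)
    (h : Filter.Tendsto f Filter.atTop Filter.atBot) : ∃ B, ∀ s, f s ≤ B := by
  obtain ⟨a, ha⟩ := Filter.eventually_atTop.1 (h.eventually_le_atBot 0)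
  obtain ⟨B, hB⟩ := (isCompact_Icc (a := (0 : ℝ)) (b := a)).bddAbove_image hf.continuousOn
  have key : ∀ s, 0 ≤ s → f s ≤ max B 0 := by
    intro s hs
    rcases le_total s a with h1 | h1
    · exact le_max_of_le_left (hB ⟨s, ⟨hs, h1⟩, rfl⟩)
    · exact le_max_of_le_right (ha s h1)
  refine ⟨max B 0, fun s => ?_⟩
  rcases le_total 0 s with hs | hs
  · exact key s hs
  · rw [← he]
    exact key _ (by linarith)

/-- The real term `s^n` drops out of the imaginary part, leaving an even polynomial with leading
term `-n s^{n-1}`. For `n = 3` adding `s²/2` still leaves the leading coefficient `-3 + 1/2`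
negative. -/
lemma exists_im_sub_I_pow_le {n : ℕ} (hn : 3 ≤ n) (hodd : Odd n) :
    ∃ B : ℝ, ∀ s : ℝ, (((s : ℂ) - Complex.I) ^ n).im ≤ B - s ^ 2 / 2 := by
  set q : ℝ[X] := ∑ k ∈ Finset.range n,
    C (((-Complex.I) ^ (n - k) * (n.choose k : ℂ)).im) * X ^ k with hq
  have heval : ∀ s : ℝ, (((s : ℂ) - Complex.I) ^ n).im = q.eval s := by
    intro s
    rw [sub_eq_add_neg, add_pow, Finset.sum_range_succ, hq, eval_finsetSum]
    simp only [Complex.add_im, Complex.im_sum]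
    have : (((s : ℂ) ^ n * (-Complex.I) ^ (n - n) * (n.choose n : ℂ))).im = 0 := by
      rw [Nat.sub_self, pow_zero, mul_one, Nat.choose_self, Nat.cast_one, mul_one,
        ← Complex.ofReal_pow, Complex.ofReal_im]
    rw [this, add_zero]
    refine Finset.sum_congr rfl fun k _ => ?_
    rw [mul_assoc, ← Complex.ofReal_pow, Complex.im_ofReal_mul]
    simp [mul_comm]
  have hcoeff : ∀ k, q.coeff k
      = if k < n then ((-Complex.I) ^ (n - k) * (n.choose k : ℂ)).im else 0 := by
    intro k
    rw [hq, finsetSum_coeff]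
    simp only [coeff_C_mul_X_pow, Finset.sum_ite_eq, Finset.mem_range]
  set p : ℝ[X] := q + C (1 / 2) * X ^ 2 with hp
  have hpc : ∀ k, p.coeff k = q.coeff k + if k = 2 then 1 / 2 else 0 := by
    intro k
    rw [hp, coeff_add, coeff_C_mul_X_pow]
  have htop : p.coeff (n - 1) < 0 := by
    have h1 : q.coeff (n - 1) = -n := by
      rw [hcoeff, if_pos (by omega), show n - (n - 1) = 1 by omega, pow_one,
        Nat.choose_symm_of_eq_add (show n = n - 1 + 1 by omega), Nat.choose_one_right]
      simp
    have h3 : (3 : ℝ) ≤ n := by exact_mod_cast hn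
    rw [hpc, h1]
    split_ifs <;> linarith
  have hdeg : p.natDegree = n - 1 := by
    refine le_antisymm (natDegree_le_iff_coeff_eq_zero.2 fun k hk => ?_)
      (le_natDegree_of_ne_zero htop.ne)
    rw [hpc, hcoeff, if_neg (by omega), if_neg (by omega), add_zero]
  have ht : Filter.Tendsto (fun s => p.eval s) Filter.atTop Filter.atBot := by
    refine p.tendsto_atBot_of_leadingCoeff_nonpos ?_ ?_
    · exact natDegree_pos_iff_degree_pos.1 (by omega)
    · rw [leadingCoeff, hdeg]; exact htop.le
  have hpe : ∀ s, p.eval s = (((s : ℂ) - Complex.I) ^ n).im + s ^ 2 / 2 := by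
    intro s
    rw [hp, heval]
    simp
    ring
  obtain ⟨B, hB⟩ := exists_bound_of_even_of_tendsto p.continuous (fun s => by
    rw [hpe, hpe]
    have : ((-s : ℝ) : ℂ) - Complex.I = -(starRingEnd ℂ) ((s : ℂ) - Complex.I) := by
      simp; ring
    rw [this, hodd.neg_pow, ← map_pow, Complex.neg_im, Complex.conj_im, neg_neg, neg_sq]) ht
  refine ⟨B, fun s => ?_⟩
  have := hB s
  rw [hpe] at this
  linarith

section Airy

variable {N : ℕ} {κ : ℝ}

/-- The line of integration. -/
def airyLine (N : ℕ) (κ : ℝ) (s : ℝ) : ℂ := (airyAbscissa N κ : ℂ) + Complex.I * (s : ℂ)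

lemma IsHeatSign.sq_eq_one (hκ : IsHeatSign N κ) : κ = 1 ∨ κ = -1 := by
  rcases Nat.even_or_odd N with h | h
  · rw [hκ.1 h]; exact neg_one_pow_eq_or ℝ _
  · exact hκ.2 h

lemma IsHeatSign.ne_zero (hκ : IsHeatSign N κ) : κ ≠ 0 := by
  rcases hκ.sq_eq_one with h | h <;> simp [h]

/-- For even `N`, `κ ξ^N = -s^N` on the line. For odd `N` the sign of the abscissa `c` is such that
`κ ξ^N = -i (c s - i)^N`. -/
lemma exists_re_airyLine_pow_le (hN : 2 ≤ N) (hκ : IsHeatSign N κ) :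
    ∃ B : ℝ, ∀ s : ℝ, ((κ : ℂ) * airyLine N κ s ^ N).re ≤ B - s ^ 2 / 2 := by
  rcases Nat.even_or_odd N with h | h
  · obtain ⟨m, hm⟩ := h
    have hm' : N / 2 = m := by omega
    refine ⟨1, fun s => ?_⟩
    have h1 : ((κ : ℂ) * airyLine N κ s ^ N) = ((-(s ^ 2) ^ m : ℝ) : ℂ) := by
      rw [airyLine, airyAbscissa, if_pos ⟨m, hm⟩, hκ.1 ⟨m, hm⟩, hm', hm, ← two_mul]
      push_cast
      rw [zero_add, mul_pow, pow_mul, pow_mul, Complex.I_sq, ← mul_assoc, pow_succ]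
      have : ((-1 : ℂ) ^ m) * (-1) ^ m = 1 := by rw [← mul_pow]; simp
      linear_combination (-((s : ℂ) ^ 2) ^ m) * this
    rw [h1, Complex.ofReal_re]
    rcases le_total (s ^ 2) 1 with h2 | h2
    · have : 0 ≤ (s ^ 2) ^ m := by positivity
      linarith
    · have : s ^ 2 ≤ (s ^ 2) ^ m := le_self_pow₀ h2 (by omega)
      nlinarith
  · obtain ⟨B, hB⟩ := exists_im_sub_I_pow_le (n := N) (by obtain ⟨m, hm⟩ := h; omega) h
    have hc : ∃ c : ℝ, airyAbscissa N κ = c ∧ (c = 1 ∨ c = -1) ∧ κ * c = (-1) ^ ((N + 1) / 2) := by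
      have hne : ¬ Even N := Nat.not_even_iff_odd.2 h
      refine ⟨_, rfl, ?_⟩
      rw [airyAbscissa, if_neg hne]
      split_ifs with hk
      · exact ⟨Or.inl rfl, by rw [mul_one]; exact hk⟩
      · refine ⟨Or.inr rfl, ?_⟩
        rcases hκ.2 h with h1 | h1 <;> rcases neg_one_pow_eq_or ℝ ((N + 1) / 2) with h2 | h2 <;>
          rw [h1, h2] at hk ⊢ <;> first | exact absurd rfl hk | norm_num
    obtain ⟨c, hc0, hc1, hc2⟩ := hc
    obtain ⟨m, hm⟩ := h
    have hm' : (N + 1) / 2 = m + 1 := by omega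
    have hcc : (c : ℂ) * c = 1 := by
      rcases hc1 with h1 | h1 <;> simp [h1]
    have hcN : (c : ℂ) ^ N = c := by
      rw [hm, pow_succ, pow_mul, pow_two, hcc, one_pow, one_mul]
    refine ⟨B, fun s => ?_⟩
    have h1 : (κ : ℂ) * airyLine N κ s ^ N
        = -(Complex.I * (((c * s : ℝ) : ℂ) - Complex.I) ^ N) := by
      have e1 : airyLine N κ s = c * (Complex.I * (((c * s : ℝ) : ℂ) - Complex.I)) := by
        rw [airyLine, hc0]
        push_cast
        linear_combination (-Complex.I * s) * hcc + (c : ℂ) * Complex.I_sq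
      have e2 : (κ : ℂ) * c = (-1) ^ (m + 1) := by
        rw [← hm']; exact_mod_cast hc2
      have e3 : Complex.I ^ N = (-1) ^ m * Complex.I := by
        rw [hm, pow_succ, pow_mul, Complex.I_sq]
      have e4 : ((-1 : ℂ) ^ m) * (-1) ^ m = 1 := by rw [← mul_pow]; simp
      rw [e1, mul_pow, mul_pow, hcN, e3, ← mul_assoc, e2, pow_succ]
      linear_combination (-Complex.I * (((c * s : ℝ) : ℂ) - Complex.I) ^ N) * e4
    have h2 := hB (c * s)
    have h3 : (c * s) ^ 2 = s ^ 2 := by rcases hc1 with h1 | h1 <;> rw [h1] <;> ring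
    rw [h3] at h2
    rw [h1]
    simpa using h2

lemma exists_norm_eval_le (P : ℂ[X]) : ∃ M : ℝ, 0 ≤ M ∧ ∀ ξ : ℂ, ‖P.eval ξ‖ ≤ M * Real.exp ‖ξ‖ := by
  induction P using Polynomial.induction_on' with
  | add p q hp hq =>
    obtain ⟨M, hM, h⟩ := hp
    obtain ⟨M', hM', h'⟩ := hq
    refine ⟨M + M', by positivity, fun ξ => ?_⟩
    rw [eval_add, add_mul]
    exact (norm_add_le _ _).trans (add_le_add (h ξ) (h' ξ))
  | monomial n a =>
    refine ⟨‖a‖ * n.factorial, by positivity, fun ξ => ?_⟩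
    rw [eval_monomial, norm_mul, norm_pow, mul_assoc]
    refine mul_le_mul_of_nonneg_left ?_ (norm_nonneg _)
    have := Real.pow_div_factorial_le_exp ‖ξ‖ (norm_nonneg _) n
    rwa [div_le_iff₀ (by positivity), mul_comm] at this

lemma norm_airyLine_le (s : ℝ) : ‖airyLine N κ s‖ ≤ 1 + |s| := by
  refine (norm_add_le _ _).trans (add_le_add ?_ (by simp))
  rw [Complex.norm_real, airyAbscissa]
  split_ifs <;> simp

/-- The integrand of the Airy-type integrals, with a polynomial factor. -/
def airyIntegrand (N : ℕ) (κ : ℝ) (P : ℂ[X]) (z : ℂ) (s : ℝ) : ℂ :=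
  P.eval (airyLine N κ s) * Complex.exp (z * airyLine N κ s + (κ : ℂ) * airyLine N κ s ^ N)

/-- The Airy-type integral with a polynomial factor. -/
def airyInt (N : ℕ) (κ : ℝ) (P : ℂ[X]) (z : ℂ) : ℂ := ∫ s : ℝ, airyIntegrand N κ P z s

lemma continuous_airyLine : Continuous (airyLine N κ) := by
  unfold airyLine; fun_prop

lemma continuous_airyIntegrand (P : ℂ[X]) (z : ℂ) : Continuous (airyIntegrand N κ P z) := by
  have := continuous_airyLine (N := N) (κ := κ)
  unfold airyIntegrand
  fun_prop

/-- Half of the decay `-s²/2` absorbs the growth of `P` and of `z ξ`, both at most exponential in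
`|s|`. Uniformity in `z` permits differentiation under the integral. -/
lemma exists_norm_airyIntegrand_le (hN : 2 ≤ N) (hκ : IsHeatSign N κ) (P : ℂ[X]) (r : ℝ) :
    ∃ M : ℝ, ∀ (z : ℂ) (s : ℝ), ‖z‖ ≤ r →
      ‖airyIntegrand N κ P z s‖ ≤ M * Real.exp (-(1 / 4) * s ^ 2) := by
  obtain ⟨B, hB⟩ := exists_re_airyLine_pow_le hN hκ
  obtain ⟨M, hM, hP⟩ := exists_norm_eval_le P
  refine ⟨M * Real.exp (B + (1 + r) + (1 + r) ^ 2), fun z s hz => ?_⟩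
  have hr : 0 ≤ r := (norm_nonneg z).trans hz
  have hl := norm_airyLine_le (N := N) (κ := κ) s
  rw [airyIntegrand, norm_mul, Complex.norm_exp, Complex.add_re, mul_assoc]
  refine (mul_le_mul_of_nonneg_right (hP _) (Real.exp_nonneg _)).trans ?_
  rw [mul_assoc]
  refine mul_le_mul_of_nonneg_left ?_ hM
  rw [← Real.exp_add, ← Real.exp_add, Real.exp_le_exp]
  have h1 : (z * airyLine N κ s).re ≤ r * (1 + |s|) := by
    refine (Complex.re_le_norm _).trans ?_
    rw [norm_mul]
    exact mul_le_mul hz hl (norm_nonneg _) hr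
  have h2 := hB s
  have h3 : (1 + r) * |s| ≤ (1 + r) ^ 2 + s ^ 2 / 4 := by
    rw [← sq_abs s]
    nlinarith [sq_nonneg ((1 + r) - |s| / 2)]
  linarith

lemma integrable_airyIntegrand (hN : 2 ≤ N) (hκ : IsHeatSign N κ) (P : ℂ[X]) (z : ℂ) :
    MeasureTheory.Integrable (airyIntegrand N κ P z) := by
  obtain ⟨M, hM⟩ := exists_norm_airyIntegrand_le hN hκ P ‖z‖
  refine MeasureTheory.Integrable.mono'
    ((integrable_exp_neg_mul_sq (b := 1 / 4) (by norm_num)).const_mul M)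
    (continuous_airyIntegrand P z).aestronglyMeasurable ?_
  exact Filter.Eventually.of_forall fun s => hM z s le_rfl

lemma airyInt_add (hN : 2 ≤ N) (hκ : IsHeatSign N κ) (P Q : ℂ[X]) (z : ℂ) :
    airyInt N κ (P + Q) z = airyInt N κ P z + airyInt N κ Q z := by
  rw [airyInt, airyInt, airyInt, ← MeasureTheory.integral_add
    (integrable_airyIntegrand hN hκ P z) (integrable_airyIntegrand hN hκ Q z)]
  congr 1 with s
  simp [airyIntegrand, add_mul]

lemma airyInt_C_mul (a : ℂ) (P : ℂ[X]) (z : ℂ) :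
    airyInt N κ (C a * P) z = a * airyInt N κ P z := by
  rw [airyInt, airyInt, ← MeasureTheory.integral_const_mul]
  congr 1 with s
  simp [airyIntegrand, mul_assoc]

lemma airyInt_sum (hN : 2 ≤ N) (hκ : IsHeatSign N κ) {ι : Type*} (t : Finset ι) (P : ι → ℂ[X])
    (z : ℂ) : airyInt N κ (∑ i ∈ t, P i) z = ∑ i ∈ t, airyInt N κ (P i) z := by
  simp only [airyInt]
  rw [← MeasureTheory.integral_finsetSum t
    fun i _ => integrable_airyIntegrand hN hκ (P i) z]
  congr 1 with s
  simp [airyIntegrand, eval_finsetSum, Finset.sum_mul]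

lemma hasDerivAt_airyInt (hN : 2 ≤ N) (hκ : IsHeatSign N κ) (P : ℂ[X]) (z : ℂ) :
    HasDerivAt (airyInt N κ P) (airyInt N κ (X * P) z) z := by
  obtain ⟨M, hM⟩ := exists_norm_airyIntegrand_le hN hκ (X * P) (‖z‖ + 1)
  refine (hasDerivAt_integral_of_dominated_loc_of_deriv_le
    (F := airyIntegrand N κ P) (F' := airyIntegrand N κ (X * P))
    (bound := fun s => M * Real.exp (-(1 / 4) * s ^ 2))
    (Metric.ball_mem_nhds z one_pos)
    (Filter.Eventually.of_forall fun z => (continuous_airyIntegrand P z).aestronglyMeasurable)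
    (integrable_airyIntegrand hN hκ P z)
    (continuous_airyIntegrand (X * P) z).aestronglyMeasurable
    (Filter.Eventually.of_forall fun s z' hz' => hM z' s ?_)
    ((integrable_exp_neg_mul_sq (b := 1 / 4) (by norm_num)).const_mul M)
    (Filter.Eventually.of_forall fun s z' _ => ?_)).2
  · have := norm_le_norm_add_norm_sub' z' z
    rw [Metric.mem_ball, dist_eq_norm] at hz'
    rw [norm_sub_rev] at this
    rw [norm_sub_rev] at hz'
    linarith
  · have h := (((hasDerivAt_id z').mul_const (airyLine N κ s)).add_const
      ((κ : ℂ) * airyLine N κ s ^ N)).cexp.const_mul (P.eval (airyLine N κ s))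
    refine h.congr_deriv ?_
    simp only [airyIntegrand, eval_mul, eval_X, id]
    ring

/-- Integration by parts along the line of integration. -/
lemma airyInt_parts (hN : 2 ≤ N) (hκ : IsHeatSign N κ) (P : ℂ[X]) (z : ℂ) :
    airyInt N κ (derivative P) z + z * airyInt N κ P z
      + N * κ * airyInt N κ (X ^ (N - 1) * P) z = 0 := by
  have h1 : ∀ s, HasDerivAt (airyIntegrand N κ P z) (airyIntegrand N κ
      (C Complex.I * (derivative P + C z * P + C (N * κ : ℂ) * (X ^ (N - 1) * P))) z s) s := by
    intro s
    have hl : HasDerivAt (airyLine N κ) Complex.I s := by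
      change HasDerivAt (fun s : ℝ => (airyAbscissa N κ : ℂ) + Complex.I * (s : ℂ)) Complex.I s
      simpa using ((hasDerivAt_id (s : ℂ)).comp_ofReal.const_mul Complex.I).const_add
        (airyAbscissa N κ : ℂ)
    have hP : HasDerivAt (fun s => P.eval (airyLine N κ s))
        ((derivative P).eval (airyLine N κ s) * Complex.I) s :=
      (P.hasDerivAt _).comp s hl
    have h := hP.mul ((hl.const_mul z).add ((hl.pow N).const_mul (κ : ℂ))).cexp
    refine h.congr_deriv ?_
    simp only [airyIntegrand, eval_mul, eval_add, eval_C, eval_X, eval_pow, Pi.add_apply,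
      Pi.pow_apply]
    ring
  have h2 := MeasureTheory.integral_eq_zero_of_hasDerivAt_of_integrable h1
    (integrable_airyIntegrand hN hκ _ z) (integrable_airyIntegrand hN hκ P z)
  change airyInt N κ _ z = 0 at h2
  rw [airyInt_C_mul, mul_eq_zero, or_iff_right Complex.I_ne_zero, airyInt_add hN hκ,
    airyInt_add hN hκ, airyInt_C_mul, airyInt_C_mul] at h2
  exact h2

/-- For real `z = -2πv` the integral is, up to a nonzero factor, the Fourier transform at `v` of the
integrand for `z = 0`. By Fourier inversion that integrand vanishes, so `P` vanishes on a whole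
line. -/
lemma eq_zero_of_airyInt_eq_zero (hN : 2 ≤ N) (hκ : IsHeatSign N κ) {P : ℂ[X]}
    (h : ∀ z : ℂ, airyInt N κ P z = 0) : P = 0 := by
  have hF : FourierTransform.fourier (airyIntegrand N κ P 0) = 0 := by
    ext v
    rw [Real.fourier_eq', Pi.zero_apply]
    set z : ℂ := ((-2 * Real.pi * v : ℝ) : ℂ) with hz
    have := h z
    rw [airyInt] at this
    rw [← mul_right_inj' (Complex.exp_ne_zero (z * airyAbscissa N κ)), mul_zero]
    refine Eq.trans ?_ this
    rw [← MeasureTheory.integral_const_mul]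
    congr 1 with s
    simp only [airyIntegrand, smul_eq_mul]
    rw [mul_left_comm, mul_left_comm (Complex.exp _) (P.eval _), mul_left_comm,
      ← Complex.exp_add, ← Complex.exp_add]
    congr 2
    rw [airyLine, hz]
    simp
    ring
  have h2 := (continuous_airyIntegrand (N := N) (κ := κ) P 0).fourierInv_fourier_eq
    (integrable_airyIntegrand hN hκ P 0) (by rw [hF]; exact MeasureTheory.integrable_zero _ _ _)
  have h3 : ∀ s, airyIntegrand N κ P 0 s = 0 := by
    intro s
    rw [← h2, hF, Real.fourierInv_eq']
    simp
  refine eq_zero_of_infinite_isRoot P (Set.Infinite.mono (s := Set.range (airyLine N κ)) ?_ ?_)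
  · rintro _ ⟨s, rfl⟩
    have := h3 s
    rw [airyIntegrand, mul_eq_zero, or_iff_left (Complex.exp_ne_zero _)] at this
    exact this
  · refine Set.infinite_range_of_injective fun s s' hs => ?_
    simpa [airyLine] using hs

end Airy

/-! ### The scaled Airy terms: derivatives, relation and duality -/

section Airy

variable {N : ℕ} {κ : ℝ}

lemma iteratedDeriv_airyType (hN : 2 ≤ N) (hκ : IsHeatSign N κ) (j : ℕ) :
    iteratedDeriv j (airyType N κ)
      = fun z : ℝ => (1 / (2 * Real.pi) : ℂ) * airyInt N κ (X ^ j) z := by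
  induction j with
  | zero =>
    ext z
    simp only [iteratedDeriv_zero, airyType, airyInt, airyIntegrand, airyLine, pow_zero, eval_one,
      one_mul]
  | succ j ih =>
    ext z
    rw [iteratedDeriv_succ, ih, pow_succ']
    exact ((hasDerivAt_airyInt hN hκ (X ^ j) (z : ℂ)).comp_ofReal.const_mul _).deriv

/-- `t ^ (-1 / N)`, in terms of which the scaling of `airyTerm` is polynomial. -/
def invRoot (N : ℕ) (t : ℝ) : ℝ := t ^ (-(1 / (N : ℝ)))

lemma invRoot_pos {t : ℝ} (ht : 0 < t) : 0 < invRoot N t := Real.rpow_pos_of_pos ht _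

lemma invRoot_pow (hN : 2 ≤ N) {t : ℝ} (ht : 0 < t) : t * invRoot N t ^ N = 1 := by
  have : (N : ℝ) ≠ 0 := by positivity
  rw [invRoot, ← Real.rpow_natCast, ← Real.rpow_mul ht.le, neg_mul, one_div_mul_cancel this,
    Real.rpow_neg_one, mul_inv_cancel₀ ht.ne']

lemma invRoot_inv_pow (hN : 2 ≤ N) {r : ℝ} (hr : 0 < r) : invRoot N (r ^ N)⁻¹ = r := by
  have : (N : ℝ) ≠ 0 := by positivity
  rw [invRoot, Real.rpow_neg (by positivity), Real.inv_rpow (by positivity), inv_inv,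
    ← Real.rpow_natCast, ← Real.rpow_mul hr.le, mul_one_div_cancel this, Real.rpow_one]

lemma hasDerivAt_invRoot (hN : 2 ≤ N) {t : ℝ} (ht : 0 < t) :
    HasDerivAt (invRoot N) (-(1 / (N : ℝ)) * (invRoot N t ^ N * invRoot N t)) t := by
  have h := Real.hasDerivAt_rpow_const (p := -(1 / (N : ℝ))) (Or.inl ht.ne')
  refine h.congr_deriv ?_
  rw [eq_inv_of_mul_eq_one_right (invRoot_pow hN ht), invRoot, Real.rpow_sub_one ht.ne']
  ring

lemma airyTerm_eq (hN : 2 ≤ N) (hκ : IsHeatSign N κ) (j : ℕ) (x y : ℝ) {t : ℝ} (ht : 0 < t) :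
    airyTerm N κ j x y t = (1 / (2 * Real.pi) : ℂ) * ((invRoot N t : ℂ) ^ (j + 1) *
      airyInt N κ (X ^ j) (((x : ℂ) - y) * invRoot N t)) := by
  rw [airyTerm, iteratedDeriv_airyType hN hκ]
  have h1 : t ^ (-((j : ℝ) + 1) / (N : ℝ)) = invRoot N t ^ (j + 1) := by
    rw [invRoot, ← Real.rpow_natCast, ← Real.rpow_mul ht.le]
    congr 1
    push_cast
    ring
  have h2 : (x - y) / t ^ (1 / (N : ℝ)) = (x - y) * invRoot N t := by
    rw [invRoot, Real.rpow_neg ht.le, div_eq_mul_inv]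
  rw [h1, h2]
  push_cast
  ring

lemma hasDerivAt_airyTerm_x (hN : 2 ≤ N) (hκ : IsHeatSign N κ) (j : ℕ) (x y : ℝ) {t : ℝ}
    (ht : 0 < t) :
    HasDerivAt (fun x => airyTerm N κ j x y t) (airyTerm N κ (j + 1) x y t) x := by
  have hf : (fun x => airyTerm N κ j x y t) = fun x : ℝ => (1 / (2 * Real.pi) : ℂ) *
      ((invRoot N t : ℂ) ^ (j + 1) *
      airyInt N κ (X ^ j) (((x : ℂ) - y) * invRoot N t)) :=
    funext fun x => airyTerm_eq hN hκ j x y ht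
  rw [hf, airyTerm_eq hN hκ _ x y ht]
  have h1 : HasDerivAt (fun x : ℂ => (x - y) * (invRoot N t : ℂ)) (1 * (invRoot N t : ℂ)) (x : ℂ) :=
    ((hasDerivAt_id (x : ℂ)).sub_const _).mul_const _
  have h := (((hasDerivAt_airyInt hN hκ (X ^ j) _).comp (x : ℂ) h1).comp_ofReal.const_mul
    ((invRoot N t : ℂ) ^ (j + 1))).const_mul (1 / (2 * Real.pi) : ℂ)
  refine h.congr_deriv ?_
  rw [pow_succ' X j]
  ring

lemma hasDerivAt_airyTerm_y (hN : 2 ≤ N) (hκ : IsHeatSign N κ) (j : ℕ) (x y : ℝ) {t : ℝ}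
    (ht : 0 < t) :
    HasDerivAt (fun y => airyTerm N κ j x y t) (-airyTerm N κ (j + 1) x y t) y := by
  have hf : (fun y => airyTerm N κ j x y t) = fun y => airyTerm N κ j (x - y) 0 t := by
    ext y
    simp [airyTerm]
  have h0 : airyTerm N κ (j + 1) x y t = airyTerm N κ (j + 1) (x - y) 0 t := by
    simp [airyTerm]
  rw [hf, h0]
  have h := (hasDerivAt_airyTerm_x hN hκ j (x - y) 0 ht).scomp y ((hasDerivAt_id y).const_sub x)
  simpa [Function.comp_def] using h

/-- Integration by parts for `ξ^m`, rescaled by `r = t^{-1/N}` with `t r^N = 1`. For `m = 0` the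
truncated index `m - 1` is harmless because of the factor `m`. -/
lemma airyTerm_relation (hN : 2 ≤ N) (hκ : IsHeatSign N κ) (m : ℕ) (x y : ℝ) {t : ℝ}
    (ht : 0 < t) :
    (m : ℂ) * airyTerm N κ (m - 1) x y t + ((x : ℂ) - y) * airyTerm N κ m x y t
      + N * κ * (t * airyTerm N κ (m + (N - 1)) x y t) = 0 := by
  have h := airyInt_parts hN hκ (X ^ m) (((x : ℂ) - y) * invRoot N t)
  have hr : (t : ℂ) * (invRoot N t : ℂ) ^ N = 1 := by exact_mod_cast invRoot_pow hN ht
  have hd : derivative (X ^ m : ℂ[X]) = C (m : ℂ) * X ^ (m - 1) := by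
    rw [derivative_X_pow]
  rw [hd, airyInt_C_mul, ← pow_add, add_comm (N - 1) m] at h
  rw [airyTerm_eq hN hκ _ x y ht, airyTerm_eq hN hκ _ x y ht, airyTerm_eq hN hκ _ x y ht,
    show m + (N - 1) + 1 = m + N by omega]
  set r : ℂ := (invRoot N t : ℂ)
  have hm : (m : ℂ) * r ^ (m - 1 + 1) = m * r ^ m := by
    rcases m with _ | m
    · simp
    · simp
  linear_combination (1 / (2 * Real.pi) : ℂ) * r ^ m * h
    + (1 / (2 * Real.pi) : ℂ) * airyInt N κ (X ^ (m - 1)) (((x : ℂ) - y) * r) * hm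
    + (1 / (2 * Real.pi) : ℂ) * (N * κ * r ^ m *
      airyInt N κ (X ^ (m + (N - 1))) (((x : ℂ) - y) * r)) * hr

/-- Differentiating the scaling gives the terms `(j + 1) ξ^j` and `z ξ^{j+1}`, which integration by
parts for `ξ^{j+1}` combines into `ξ^{j+N}`. -/
lemma hasDerivAt_airyTerm_t (hN : 2 ≤ N) (hκ : IsHeatSign N κ) (j : ℕ) (x y : ℝ) {t : ℝ}
    (ht : 0 < t) :
    HasDerivAt (fun t => airyTerm N κ j x y t) (κ * airyTerm N κ (j + N) x y t) t := by
  have hf : (fun t => airyTerm N κ j x y t) =ᶠ[nhds t] fun t : ℝ => (1 / (2 * Real.pi) : ℂ) *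
      ((invRoot N t : ℂ) ^ (j + 1) *
      airyInt N κ (X ^ j) (((x : ℂ) - y) * invRoot N t)) := by
    filter_upwards [lt_mem_nhds ht] with t' ht'
    exact airyTerm_eq hN hκ j x y ht'
  refine HasDerivAt.congr_of_eventuallyEq ?_ hf
  set r' : ℝ := -(1 / (N : ℝ)) * (invRoot N t ^ N * invRoot N t) with hr'
  have h1 : HasDerivAt (fun t => (invRoot N t : ℂ)) (r' : ℂ) t :=
    (hasDerivAt_invRoot hN ht).ofReal_comp
  have h2 : HasDerivAt (fun t => airyInt N κ (X ^ j) (((x : ℂ) - y) * invRoot N t))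
      (airyInt N κ (X * X ^ j) (((x : ℂ) - y) * invRoot N t) * (((x : ℂ) - y) * r')) t :=
    (hasDerivAt_airyInt hN hκ (X ^ j) _).comp t (h1.const_mul _)
  have h := ((h1.pow (j + 1)).mul h2).const_mul (1 / (2 * Real.pi) : ℂ)
  refine h.congr_deriv ?_
  have hp := airyInt_parts hN hκ (X ^ (j + 1)) (((x : ℂ) - y) * invRoot N t)
  have hd : derivative (X ^ (j + 1) : ℂ[X]) = C ((j + 1 : ℕ) : ℂ) * X ^ j := by
    rw [derivative_X_pow, Nat.add_sub_cancel]
  rw [hd, airyInt_C_mul, ← pow_add, show N - 1 + (j + 1) = j + N by omega] at hp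
  rw [airyTerm_eq hN hκ _ x y ht, ← pow_succ', hr', Pi.pow_apply]
  have hN0 : (N : ℂ) ≠ 0 := Nat.cast_ne_zero.2 (by omega)
  rw [Nat.add_sub_cancel]
  push_cast at hp ⊢
  set r : ℂ := (invRoot N t : ℂ)
  generalize airyInt N κ (X ^ j) _ = a₀ at hp ⊢
  generalize airyInt N κ (X ^ (j + 1)) _ = a₁ at hp ⊢
  generalize airyInt N κ (X ^ (j + N)) _ = a₂ at hp ⊢
  field_simp
  linear_combination (-r ^ (j + 1) * r ^ N) * hp

lemma airyAbscissa_dual (hκ : IsHeatSign N κ) :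
    airyAbscissa N ((-1) ^ N * κ) = -airyAbscissa N κ := by
  rcases Nat.even_or_odd N with h | h
  · simp [airyAbscissa, h]
  · have hne : ¬ Even N := Nat.not_even_iff_odd.2 h
    rw [airyAbscissa, airyAbscissa, if_neg hne, if_neg hne, h.neg_one_pow]
    rcases hκ.2 h with h1 | h1 <;> rcases neg_one_pow_eq_or ℝ ((N + 1) / 2) with h2 | h2 <;>
      rw [h1, h2] <;> norm_num

/-- The substitution `ξ ↦ -ξ` carries the line of one sign to that of the dual sign. -/
lemma airyType_dual (hκ : IsHeatSign N κ) (z : ℝ) :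
    airyType N ((-1) ^ N * κ) z = airyType N κ (-z) := by
  rw [airyType, airyType, airyAbscissa_dual hκ, ← MeasureTheory.integral_neg_eq_self]
  congr 2 with s
  congr 1
  push_cast
  have : (-(airyAbscissa N κ : ℂ) + Complex.I * -(s : ℂ))
      = -((airyAbscissa N κ : ℂ) + Complex.I * s) := by ring
  rw [this, neg_pow ((airyAbscissa N κ : ℂ) + Complex.I * s)]
  have h1 : ((-1 : ℂ) ^ N) * (-1) ^ N = 1 := by rw [← mul_pow]; simp
  linear_combination (κ : ℂ) * ((airyAbscissa N κ : ℂ) + Complex.I * s) ^ N * h1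

lemma airyTerm_dual (hκ : IsHeatSign N κ) (j : ℕ) (x y t : ℝ) :
    airyTerm N ((-1) ^ N * κ) j y x t = (-1) ^ j * airyTerm N κ j x y t := by
  have h : airyType N ((-1) ^ N * κ) = fun z => airyType N κ (-z) :=
    funext (airyType_dual hκ)
  rw [airyTerm, airyTerm, h, iteratedDeriv_comp_neg, ← neg_div, neg_sub]
  simp only [Complex.real_smul]
  push_cast
  ring

/-! ### Linear independence of the Airy terms -/

/-- Multiplication by `z`, on the polynomial factor of an Airy-type integral. -/
def airyMul (N : ℕ) (κ : ℝ) : Module.End ℂ ℂ[X] :=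
  -(derivative + (N * κ : ℂ) • LinearMap.mulLeft ℂ (X ^ (N - 1)))

lemma airyMul_apply (P : ℂ[X]) :
    airyMul N κ P = -(derivative P + C (N * κ : ℂ) * (X ^ (N - 1) * P)) := by
  rw [← smul_eq_C_mul]; rfl

lemma airyInt_airyMul (hN : 2 ≤ N) (hκ : IsHeatSign N κ) (P : ℂ[X]) (z : ℂ) :
    airyInt N κ (airyMul N κ P) z = z * airyInt N κ P z := by
  have h := airyInt_parts hN hκ P z
  rw [airyMul_apply, neg_eq_neg_one_mul, ← C_1, ← C_neg, airyInt_C_mul, airyInt_add hN hκ,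
    airyInt_C_mul]
  linear_combination -h

lemma airyInt_airyMul_pow (hN : 2 ≤ N) (hκ : IsHeatSign N κ) (P : ℂ[X]) (k : ℕ) (z : ℂ) :
    airyInt N κ ((airyMul N κ ^ k) P) z = z ^ k * airyInt N κ P z := by
  induction k with
  | zero => simp
  | succ k ih =>
    rw [pow_succ', Module.End.mul_apply, airyInt_airyMul hN hκ, ih]
    ring

lemma degree_airyMul (hN : 2 ≤ N) (hκ : IsHeatSign N κ) {P : ℂ[X]} {n : ℕ} (hP : P.degree = n) :
    (airyMul N κ P).degree = ((n + (N - 1) : ℕ) : WithBot ℕ) := by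
  have hP0 : P ≠ 0 := by rintro rfl; simp at hP
  have hN0 : (N : ℂ) ≠ 0 := Nat.cast_ne_zero.2 (by omega)
  have h1 : (C (N * κ : ℂ) * (X ^ (N - 1) * P)).degree = ((n + (N - 1) : ℕ) : WithBot ℕ) := by
    rw [degree_C_mul (mul_ne_zero hN0 (by exact_mod_cast hκ.ne_zero)), degree_mul, degree_X_pow,
      hP, add_comm]
    rfl
  rw [airyMul_apply, degree_neg, degree_add_eq_right_of_degree_lt, h1]
  rw [h1]
  refine (degree_derivative_lt hP0).trans_le ?_
  rw [hP]
  exact_mod_cast Nat.le_add_right _ _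

lemma degree_airyMul_pow (hN : 2 ≤ N) (hκ : IsHeatSign N κ) (j k : ℕ) :
    ((airyMul N κ ^ k) (X ^ j)).degree = ((j + (N - 1) * k : ℕ) : WithBot ℕ) := by
  induction k with
  | zero => simp
  | succ k ih =>
    rw [pow_succ', Module.End.mul_apply, degree_airyMul hN hκ ih, mul_add, mul_one, ← add_assoc]

/-- The derivatives of order less than `N - 1` of the Airy-type function are linearly independent
over the polynomials. -/
lemma airyInt_independent (hN : 2 ≤ N) (hκ : IsHeatSign N κ) (p : ℕ → ℂ[X])
    (h : ∀ z : ℂ, ∑ j ∈ Finset.range (N - 1), (p j).eval z * airyInt N κ (X ^ j) z = 0) :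
    ∀ j < N - 1, p j = 0 := by
  have : NeZero (N - 1) := ⟨by omega⟩
  -- The product of `z^k` and the integral of `ξ^j` has a polynomial factor of degree `j + (N - 1)
  -- k`. For `j < N - 1`, division with remainder shows that each degree occurs exactly once.
  let S : Polynomial.Sequence ℂ :=
    { elems' := fun n => (airyMul N κ ^ (n / (N - 1))) (X ^ (n % (N - 1)))
      degree_eq' := fun n => by rw [degree_airyMul_pow hN hκ, Nat.mod_add_div] }
  have hS := S.linearIndependent.comp _ (Nat.divModEquiv (N - 1)).symm.injective
  have hSa : ∀ (k : ℕ) (j : Fin (N - 1)), S ((Nat.divModEquiv (N - 1)).symm (k, j))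
      = (airyMul N κ ^ k) (X ^ (j : ℕ)) := by
    intro k j
    change (airyMul N κ ^ (((Nat.divModEquiv (N - 1)).symm (k, j)) / (N - 1)))
      (X ^ (((Nat.divModEquiv (N - 1)).symm (k, j)) % (N - 1))) = _
    have hj := j.2
    have e : (Nat.divModEquiv (N - 1)).symm (k, j) = k * (N - 1) + j := by
      simp [Nat.divModEquiv]
    rw [e, Nat.add_comm, Nat.add_mul_div_right _ _ (by omega), Nat.add_mul_mod_self_right,
      Nat.div_eq_of_lt hj, Nat.mod_eq_of_lt hj, zero_add]
  set D := (Finset.range (N - 1)).sup (fun j => (p j).natDegree) + 1 with hD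
  have hdeg : ∀ j < N - 1, (p j).natDegree < D := fun j hj =>
    Nat.lt_succ_of_le (Finset.le_sup (f := fun j => (p j).natDegree) (Finset.mem_range.2 hj))
  rw [linearIndependent_iff'] at hS
  have key := hS (Finset.range D ×ˢ Finset.univ) (fun kj => (p kj.2).coeff kj.1) (by
    refine eq_zero_of_airyInt_eq_zero hN hκ fun z => ?_
    rw [airyInt_sum hN hκ, Finset.sum_product_right, ← h z, ← Fin.sum_univ_eq_sum_range
      (fun j => (p j).eval z * airyInt N κ (X ^ j) z)]
    refine Finset.sum_congr rfl fun j _ => ?_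
    rw [eval_eq_sum_range' (hdeg j j.2), Finset.sum_mul]
    refine Finset.sum_congr rfl fun k _ => ?_
    rw [Function.comp_apply, hSa, smul_eq_C_mul, airyInt_C_mul, airyInt_airyMul_pow hN hκ,
      mul_assoc])
  intro j hj
  ext k
  rw [coeff_zero]
  rcases lt_or_ge k D with hk | hk
  · exact key (k, ⟨j, hj⟩) (by simpa using hk)
  · exact coeff_eq_zero_of_natDegree_lt ((hdeg j hj).trans_le hk)

/-- Off the diagonal, the functions `airyTerm N κ j x y`, `j < N - 1`, of `t > 0` are linearly
independent over the polynomials in `t`. -/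
lemma airyTerm_independent (hN : 2 ≤ N) (hκ : IsHeatSign N κ) {x y : ℝ} (hxy : x ≠ y)
    (b : ℕ → ℂ[X]) (h : ∀ t : ℝ, 0 < t →
      ∑ j ∈ Finset.range (N - 1), (b j).eval (t : ℂ) * airyTerm N κ j x y t = 0) :
    ∀ j < N - 1, b j = 0 := by
  set D := (Finset.range (N - 1)).sup (fun j => (b j).natDegree) with hD
  have hdeg : ∀ j < N - 1, (b j).natDegree ≤ D := fun j hj =>
    Finset.le_sup (f := fun j => (b j).natDegree) (Finset.mem_range.2 hj)
  have hw : ((x : ℂ) - y) ≠ 0 := by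
    rw [sub_ne_zero]; exact_mod_cast hxy
  set w : ℂ := (x : ℂ) - y with hwdef
  -- In terms of `r = t^{-1/N}` one has `t = r^{-N}`, and the factor `r^{N D}` clears the
  -- denominators.
  let q : ℕ → ℂ[X] := fun j =>
    ∑ k ∈ Finset.range (D + 1), C ((b j).coeff k) * X ^ (N * (D - k) + (j + 1))
  have hq : ∀ j < N - 1, ∀ r : ℝ, 0 < r → (q j).eval (r : ℂ) =
      (r : ℂ) ^ (N * D) * ((b j).eval (((r ^ N)⁻¹ : ℝ) : ℂ) * (r : ℂ) ^ (j + 1)) := by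
    intro j hj r hr
    have hr0 : (r : ℂ) ≠ 0 := by exact_mod_cast hr.ne'
    rw [eval_eq_sum_range' (Nat.lt_succ_of_le (hdeg j hj)), eval_finsetSum, Finset.sum_mul,
      Finset.mul_sum]
    refine Finset.sum_congr rfl fun k hk => ?_
    have hk' : k ≤ D := Nat.lt_succ_iff.1 (Finset.mem_range.1 hk)
    have hk2 : (r : ℂ) ^ (N * D) = (r : ℂ) ^ (N * (D - k)) * ((r : ℂ) ^ N) ^ k := by
      rw [← pow_mul, ← pow_add, ← mul_add, Nat.sub_add_cancel hk']
    rw [eval_mul, eval_C, eval_pow, eval_X, hk2]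
    push_cast
    rw [inv_pow]
    field_simp
    ring
  -- The left side is entire in `r` and vanishes for `r > 0`, hence everywhere. As `w ≠ 0`, the
  -- argument `w r` is then an arbitrary complex number.
  have hvan : ∀ r : ℂ, ∑ j ∈ Finset.range (N - 1),
      (q j).eval r * airyInt N κ (X ^ j) (w * r) = 0 := by
    set g : ℂ → ℂ := fun r => ∑ j ∈ Finset.range (N - 1),
      (q j).eval r * airyInt N κ (X ^ j) (w * r) with hg
    have hgd : Differentiable ℂ g := by
      refine Differentiable.fun_sum fun j _ => (q j).differentiable.mul ?_
      have : Differentiable ℂ (airyInt N κ (X ^ j)) :=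
        fun z => (hasDerivAt_airyInt hN hκ _ z).differentiableAt
      exact this.comp (differentiable_id.const_mul w)
    have hreal : ∀ r : ℝ, 0 < r → g (r : ℂ) = 0 := by
      intro r hr
      have h1 := h (r ^ N)⁻¹ (by positivity)
      have hpi : (1 / (2 * Real.pi) : ℂ) ≠ 0 := by
        have : (Real.pi : ℂ) ≠ 0 := by exact_mod_cast Real.pi_ne_zero
        simp [this]
      have h2 : (1 / (2 * Real.pi) : ℂ) * g r = 0 := by
        rw [← mul_zero ((r : ℂ) ^ (N * D)), ← h1, hg, Finset.mul_sum, Finset.mul_sum]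
        refine Finset.sum_congr rfl fun j hj => ?_
        rw [hq j (Finset.mem_range.1 hj) r hr,
          airyTerm_eq hN hκ j x y (show (0 : ℝ) < (r ^ N)⁻¹ by positivity),
          invRoot_inv_pow hN hr, ← hwdef]
        ring
      exact (mul_eq_zero.1 h2).resolve_left hpi
    have hga : AnalyticOnNhd ℂ g Set.univ := fun z _ => hgd.analyticAt z
    have hfreq : ∃ᶠ z in nhdsWithin (1 : ℂ) {1}ᶜ, g z = (0 : ℂ → ℂ) z := by
      have ht : Filter.Tendsto (fun r : ℝ => (r : ℂ)) (nhdsWithin 1 (Set.Ioi 1))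
          (nhdsWithin (1 : ℂ) {1}ᶜ) := by
        refine tendsto_nhdsWithin_iff.2 ⟨?_, ?_⟩
        · have : Filter.Tendsto (fun r : ℝ => (r : ℂ)) (nhds 1) (nhds ((1 : ℝ) : ℂ)) :=
            Complex.continuous_ofReal.tendsto 1
          rw [Complex.ofReal_one] at this
          exact this.mono_left nhdsWithin_le_nhds
        · filter_upwards [self_mem_nhdsWithin] with r hr
          have hr : (1 : ℝ) < r := hr
          simpa using hr.ne'
      refine ht.frequently (Filter.Eventually.frequently ?_)
      filter_upwards [self_mem_nhdsWithin] with r hr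
      exact hreal r (lt_trans one_pos hr)
    have := hga.eqOn_of_preconnected_of_frequently_eq (g := 0) (fun z _ => analyticAt_const)
      isPreconnected_univ (Set.mem_univ 1) hfreq
    exact fun r => this (Set.mem_univ r)
  have hp := airyInt_independent hN hκ (fun j => (q j).comp (C w⁻¹ * X)) fun z => by
    rw [← hvan (w⁻¹ * z)]
    refine Finset.sum_congr rfl fun j _ => ?_
    rw [eval_comp, mul_inv_cancel_left₀ hw]
    simp
  intro j hj
  have hqz : ∀ r : ℂ, (q j).eval r = 0 := by
    intro r
    have := congrArg (eval (w * r)) (hp j hj)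
    rw [eval_comp] at this
    simpa [inv_mul_cancel_left₀ hw] using this
  refine eq_zero_of_infinite_isRoot _
    (Set.Infinite.mono (s := (fun t : ℝ => (t : ℂ)) '' Set.Ioi 0) ?_
      ((Set.Ioi_infinite 0).image Complex.ofReal_injective.injOn))
  rintro _ ⟨t, ht, rfl⟩
  have ht : 0 < t := ht
  have h1 := hq j hj _ (invRoot_pos (N := N) ht)
  have hne : (invRoot N t : ℂ) ≠ 0 := by exact_mod_cast (invRoot_pos ht).ne'
  rw [hqz, ← eq_inv_of_mul_eq_one_left (invRoot_pow hN ht)] at h1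
  have h2 := (mul_eq_zero.1 h1.symm).resolve_left (pow_ne_zero _ hne)
  exact (mul_eq_zero.1 h2).resolve_right (pow_ne_zero _ hne)

end Airy

/-! ### The algebra of smooth functions on an open set -/

section Smooth

variable (Ω : TopologicalSpace.Opens (ℝ × ℝ))

/-- The algebra of smooth complex functions on an open subset of the plane. -/
def smoothAlg : Subalgebra ℂ (Ω → ℂ) where
  carrier := {f | ∃ F : ℝ × ℝ → ℂ, ContDiffOn ℝ ∞ F Ω ∧ ∀ p : Ω, f p = F p}
  mul_mem' := by
    rintro f g ⟨F, hF, hf⟩ ⟨G, hG, hg⟩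
    exact ⟨F * G, hF.mul hG, fun p => by simp [hf, hg]⟩
  add_mem' := by
    rintro f g ⟨F, hF, hf⟩ ⟨G, hG, hg⟩
    exact ⟨F + G, hF.add hG, fun p => by simp [hf, hg]⟩
  algebraMap_mem' c := ⟨fun _ => c, contDiffOn_const, fun p => rfl⟩

/-- The type of smooth complex functions on an open subset of the plane. -/
def SmoothFun : Type := smoothAlg Ω

instance : CommRing (SmoothFun Ω) := inferInstanceAs (CommRing (smoothAlg Ω))

instance : Algebra ℂ (SmoothFun Ω) := inferInstanceAs (Algebra ℂ (smoothAlg Ω))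

variable {Ω}

/-- Evaluation at a point. -/
def evalHom (p : Ω) : SmoothFun Ω →ₐ[ℂ] ℂ :=
  (Pi.evalAlgHom ℂ (fun _ : Ω => ℂ) p).comp (smoothAlg Ω).val

/-- Restriction to `Ω` of a function which is smooth there. -/
def restr (F : ℝ × ℝ → ℂ) (hF : ContDiffOn ℝ ∞ F Ω) : SmoothFun Ω :=
  (⟨fun p => F p, F, hF, fun _ => rfl⟩ : smoothAlg Ω)

/-- Extension by zero. -/
def ext : SmoothFun Ω →ₗ[ℂ] (ℝ × ℝ → ℂ) :=
  Function.ExtendByZero.linearMap ℂ (Subtype.val : Ω → ℝ × ℝ) ∘ₗ (smoothAlg Ω).val.toLinearMap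

lemma ext_apply (f : SmoothFun Ω) {p : ℝ × ℝ} (hp : p ∈ Ω) : ext f p = evalHom ⟨p, hp⟩ f :=
  Subtype.val_injective.extend_apply (fun q : Ω => evalHom q f) (0 : ℝ × ℝ → ℂ) ⟨p, hp⟩

lemma ext_restr {F : ℝ × ℝ → ℂ} (hF : ContDiffOn ℝ ∞ F Ω) {p : ℝ × ℝ} (hp : p ∈ Ω) :
    ext (restr F hF) p = F p :=
  ext_apply _ hp

lemma smoothFun_ext {f g : SmoothFun Ω} (h : ∀ p ∈ Ω, ext f p = ext g p) : f = g := by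
  refine Subtype.ext (funext fun p => ?_)
  have := h p p.2
  rwa [ext_apply _ p.2, ext_apply _ p.2] at this

lemma ext_mul (f g : SmoothFun Ω) {p : ℝ × ℝ} (hp : p ∈ Ω) :
    ext (f * g) p = ext f p * ext g p := by
  rw [ext_apply _ hp, ext_apply _ hp, ext_apply _ hp, map_mul]

lemma ext_one {p : ℝ × ℝ} (hp : p ∈ Ω) : ext (1 : SmoothFun Ω) p = 1 := by
  rw [ext_apply _ hp, map_one]

lemma ext_natCast (n : ℕ) {p : ℝ × ℝ} (hp : p ∈ Ω) : ext (n : SmoothFun Ω) p = n := by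
  rw [ext_apply _ hp, map_natCast]

lemma ext_natCast_mul (n : ℕ) (f : SmoothFun Ω) (p : ℝ × ℝ) :
    ext ((n : SmoothFun Ω) * f) p = n * ext f p := by
  rw [← nsmul_eq_mul, map_nsmul, Pi.smul_apply, nsmul_eq_mul]

lemma contDiffOn_ext (f : SmoothFun Ω) : ContDiffOn ℝ ∞ (ext f) Ω := by
  obtain ⟨F, hF, h⟩ := f.2
  exact hF.congr fun p hp => by rw [ext_apply f hp]; exact h ⟨p, hp⟩

lemma contDiffAt_ext (f : SmoothFun Ω) {p : ℝ × ℝ} (hp : p ∈ Ω) : ContDiffAt ℝ ∞ (ext f) p :=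
  (contDiffOn_ext f).contDiffAt (Ω.isOpen.mem_nhds hp)

lemma differentiableAt_ext (f : SmoothFun Ω) {p : ℝ × ℝ} (hp : p ∈ Ω) :
    DifferentiableAt ℝ (ext f) p :=
  (contDiffAt_ext f hp).differentiableAt (by simp)

lemma contDiffOn_fderiv_ext (f : SmoothFun Ω) (v : ℝ × ℝ) :
    ContDiffOn ℝ ∞ (fun p => fderiv ℝ (ext f) p v) Ω :=
  ((contDiffOn_ext f).fderiv_of_isOpen Ω.isOpen (m := ∞) (by simp)).clm_apply contDiffOn_const

/-- The directional derivative, as a linear map. -/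
def dirDerLin (v : ℝ × ℝ) : SmoothFun Ω →ₗ[ℂ] SmoothFun Ω where
  toFun f := restr (fun p => fderiv ℝ (ext f) p v) (contDiffOn_fderiv_ext f v)
  map_add' f g := smoothFun_ext fun p hp => by
    rw [ext_restr _ hp, map_add, map_add, Pi.add_apply, ext_restr _ hp, ext_restr _ hp,
      fderiv_add (differentiableAt_ext f hp) (differentiableAt_ext g hp)]
    rfl
  map_smul' c f := smoothFun_ext fun p hp => by
    rw [ext_restr _ hp, RingHom.id_apply, map_smul, map_smul, Pi.smul_apply, ext_restr _ hp,
      fderiv_const_smul (differentiableAt_ext f hp)]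
    rfl

lemma ext_dirDerLin (v : ℝ × ℝ) (f : SmoothFun Ω) {p : ℝ × ℝ} (hp : p ∈ Ω) :
    ext (dirDerLin v f) p = fderiv ℝ (ext f) p v :=
  ext_restr _ hp

lemma dirDerLin_mul (v : ℝ × ℝ) (f g : SmoothFun Ω) :
    dirDerLin v (f * g) = f * dirDerLin v g + g * dirDerLin v f := by
  refine smoothFun_ext fun p hp => ?_
  have h : ext (f * g) =ᶠ[nhds p] fun q => ext f q * ext g q :=
    Filter.eventuallyEq_of_mem (Ω.isOpen.mem_nhds hp) fun q hq => ext_mul f g hq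
  rw [map_add, Pi.add_apply, ext_mul _ _ hp, ext_mul _ _ hp, ext_dirDerLin _ _ hp,
    ext_dirDerLin _ _ hp, ext_dirDerLin _ _ hp, h.fderiv_eq,
    fderiv_fun_mul (differentiableAt_ext f hp) (differentiableAt_ext g hp)]
  rfl

/-- The directional derivative, as a derivation of `SmoothFun Ω`. -/
def dirDer (v : ℝ × ℝ) : Derivation ℂ (SmoothFun Ω) (SmoothFun Ω) :=
  Derivation.mk' (dirDerLin v) (dirDerLin_mul v)

lemma ext_dirDer (v : ℝ × ℝ) (f : SmoothFun Ω) {p : ℝ × ℝ} (hp : p ∈ Ω) :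
    ext (dirDer v f) p = fderiv ℝ (ext f) p v :=
  ext_dirDerLin v f hp

lemma dirDer_comm (v v' : ℝ × ℝ) (f : SmoothFun Ω) :
    dirDer v (dirDer v' f) = dirDer v' (dirDer v f) := by
  refine smoothFun_ext fun p hp => ?_
  have key : ∀ a b : ℝ × ℝ, ext (dirDer a (dirDer b f)) p
      = fderiv ℝ (fderiv ℝ (ext f)) p a b := by
    intro a b
    have h : ext (dirDer b f) =ᶠ[nhds p] fun q => fderiv ℝ (ext f) q b :=
      Filter.eventuallyEq_of_mem (Ω.isOpen.mem_nhds hp) fun q hq => ext_dirDer b f hq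
    have hd : DifferentiableAt ℝ (fderiv ℝ (ext f)) p :=
      ((contDiffAt_ext f hp).fderiv_right (m := ∞) (by simp)).differentiableAt (by simp)
    rw [ext_dirDer _ _ hp, h.fderiv_eq, fderiv_clm_apply hd (differentiableAt_const b)]
    simp
  rw [key, key]
  exact ((contDiffAt_ext f hp).isSymmSndFDerivAt
    (by rw [minSmoothness_of_isRCLikeNormedField]; exact WithTop.coe_le_coe.2 (le_top (a := (2 : ℕ∞))))).eq v v'

lemma hasDerivAt_ext_x (f : SmoothFun Ω) {x y : ℝ} (h : (x, y) ∈ Ω) :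
    HasDerivAt (fun s => ext f (s, y)) (ext (dirDer (1, 0) f) (x, y)) x := by
  rw [ext_dirDer _ _ h]
  exact (differentiableAt_ext f h).hasFDerivAt.comp_hasDerivAt x
    ((hasDerivAt_id x).prodMk (hasDerivAt_const x y))

lemma hasDerivAt_ext_y (f : SmoothFun Ω) {x y : ℝ} (h : (x, y) ∈ Ω) :
    HasDerivAt (fun s => ext f (x, s)) (ext (dirDer (0, 1) f) (x, y)) y := by
  rw [ext_dirDer _ _ h]
  exact (differentiableAt_ext f h).hasFDerivAt.comp_hasDerivAt y
    ((hasDerivAt_const y x).prodMk (hasDerivAt_id y))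

end Smooth

/-! ### Transport on a square -/

/-- Multiplied by `(s - y)^{k-1}`, the equation says that `(s - y)^k φ` is constant, and it vanishes
at `s = y`. The interval must contain `y`, which is why squares are used. -/
lemma eq_zero_of_transport {a b y : ℝ} {φ φ' : ℝ → ℂ} (hy : y ∈ Set.Ioo a b)
    (hd : ∀ s ∈ Set.Ioo a b, HasDerivAt φ (φ' s) s) {k : ℕ} (hk : 1 ≤ k)
    (h : ∀ s ∈ Set.Ioo a b, (k : ℂ) * φ s + ((s : ℂ) - y) * φ' s = 0) :
    ∀ x ∈ Set.Ioo a b, φ x = 0 := by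
  intro x hx
  rcases eq_or_ne x y with rfl | hxy
  · have h1 := h x hx
    rw [sub_self, zero_mul, add_zero, mul_eq_zero] at h1
    exact h1.resolve_left (Nat.cast_ne_zero.2 (by omega))
  · have hg : ∀ s ∈ Set.Ioo a b, HasDerivAt (fun s : ℝ => ((s : ℂ) - y) ^ k * φ s) 0 s := by
      intro s hs
      have h1 : HasDerivAt (fun s : ℝ => (s : ℂ) - y) 1 s :=
        (hasDerivAt_id (s : ℂ)).comp_ofReal.sub_const _
      refine ((h1.pow k).mul (hd s hs)).congr_deriv ?_
      obtain ⟨m, rfl⟩ : ∃ m, k = m + 1 := ⟨k - 1, by omega⟩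
      rw [Nat.add_sub_cancel, Pi.pow_apply]
      linear_combination ((s : ℂ) - y) ^ m * h s hs
    have h2 := isOpen_Ioo.is_const_of_deriv_eq_zero isPreconnected_Ioo
      (fun s hs => (hg s hs).differentiableAt.differentiableWithinAt)
      (fun s hs => (hg s hs).deriv) hx hy
    simp only [sub_self] at h2
    rw [zero_pow (by omega), zero_mul, mul_eq_zero] at h2
    refine h2.resolve_left (pow_ne_zero _ ?_)
    rw [sub_ne_zero]
    exact_mod_cast hxy

/-- The open square on an interval. -/
def square (a b : ℝ) : TopologicalSpace.Opens (ℝ × ℝ) :=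
  ⟨Set.Ioo a b ×ˢ Set.Ioo a b, isOpen_Ioo.prod isOpen_Ioo⟩

lemma mem_square {a b x y : ℝ} :
    (x, y) ∈ square a b ↔ x ∈ Set.Ioo a b ∧ y ∈ Set.Ioo a b := Iff.rfl

lemma contDiffOn_fst_square {a b : ℝ} {v : ℝ → ℂ} (hv : ContDiffOn ℝ ∞ v (Set.Ioo a b)) :
    ContDiffOn ℝ ∞ (fun p : ℝ × ℝ => v p.1) (square a b) :=
  hv.comp contDiffOn_fst fun _ hp => hp.1

lemma contDiffOn_snd_square {a b : ℝ} {v : ℝ → ℂ} (hv : ContDiffOn ℝ ∞ v (Set.Ioo a b)) :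
    ContDiffOn ℝ ∞ (fun p : ℝ × ℝ => v p.2) (square a b) :=
  hv.comp contDiffOn_snd fun _ hp => hp.2

lemma contDiffOn_diff {s : Set (ℝ × ℝ)} :
    ContDiffOn ℝ ∞ (fun p : ℝ × ℝ => (p.1 : ℂ) - p.2) s :=
  ((Complex.ofRealCLM.contDiff.comp contDiff_fst).sub
    (Complex.ofRealCLM.contDiff.comp contDiff_snd)).contDiffOn

/-- The functions on the square which vanish on the diagonal. -/
def diagIdeal (a b : ℝ) : Ideal (SmoothFun (square a b)) where
  carrier := {f | ∀ x ∈ Set.Ioo a b, ext f (x, x) = 0}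
  add_mem' := fun {f g} hf hg x hx => by rw [map_add, Pi.add_apply, hf x hx, hg x hx, add_zero]
  zero_mem' := fun x _ => by rw [map_zero, Pi.zero_apply]
  smul_mem' := fun f g hg x hx => by
    rw [smul_eq_mul, ext_mul _ _ (mem_square.2 ⟨hx, hx⟩), hg x hx, mul_zero]

/-- Smooth functions on a square, with the coefficients `u` of the operator in each variable. -/
def squareAlg (a b : ℝ) {N : ℕ} (hN : 2 ≤ N) {κ : ℂ} (hκ : κ ≠ 0) {u : ℕ → ℝ → ℂ}
    (hu : ∀ i, ContDiffOn ℝ ∞ (u i) (Set.Ioo a b)) :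
    TransportAlgebra (SmoothFun (square a b)) where
  dx := dirDer (1, 0)
  dy := dirDer (0, 1)
  dx_dy := dirDer_comm _ _
  w := restr (fun p => (p.1 : ℂ) - p.2) contDiffOn_diff
  dx_w := smoothFun_ext fun ⟨x, y⟩ hp => by
    refine (hasDerivAt_ext_x _ hp).unique ?_
    rw [ext_one hp]
    refine HasDerivAt.congr_of_eventuallyEq (f := fun s : ℝ => (s : ℂ) - y)
      ((hasDerivAt_id (x : ℂ)).comp_ofReal.sub_const _) ?_
    filter_upwards [isOpen_Ioo.mem_nhds hp.1] with s hs
    exact ext_restr _ (mem_square.2 ⟨hs, hp.2⟩)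
  dy_w := smoothFun_ext fun ⟨x, y⟩ hp => by
    refine (hasDerivAt_ext_y _ hp).unique ?_
    rw [map_neg, Pi.neg_apply, ext_one hp]
    refine HasDerivAt.congr_of_eventuallyEq (f := fun s : ℝ => (x : ℂ) - s)
      ((hasDerivAt_id (y : ℂ)).comp_ofReal.const_sub _) ?_
    filter_upwards [isOpen_Ioo.mem_nhds hp.2] with s hs
    exact ext_restr _ (mem_square.2 ⟨hp.1, hs⟩)
  diag := diagIdeal a b
  w_mem := fun x hx => by rw [ext_restr _ (mem_square.2 ⟨hx, hx⟩), sub_self]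
  transport_x k c hk h := smoothFun_ext fun ⟨x, y⟩ hp => by
    rw [map_zero, Pi.zero_apply]
    refine eq_zero_of_transport (φ := fun s => ext c (s, y)) hp.2
      (fun s hs => hasDerivAt_ext_x c (mem_square.2 ⟨hs, hp.2⟩)) hk (fun s hs => ?_) x hp.1
    have hm := mem_square.2 ⟨hs, hp.2⟩
    have := congrArg (fun f => ext f (s, y)) h
    simpa [ext_mul _ _ hm, ext_natCast _ hm, ext_restr _ hm] using this
  transport_y k c hk h := smoothFun_ext fun ⟨x, y⟩ hp => by
    rw [map_zero, Pi.zero_apply]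
    refine eq_zero_of_transport (φ := fun s => ext c (x, s)) hp.1
      (fun s hs => hasDerivAt_ext_y c (mem_square.2 ⟨hp.1, hs⟩)) hk (fun s hs => ?_) y hp.2
    have hm := mem_square.2 ⟨hp.1, hs⟩
    have := congrArg (fun f => ext f (x, s)) h
    simp only [map_sub, Pi.sub_apply, ext_mul _ _ hm, ext_natCast _ hm, ext_restr _ hm,
      map_zero, Pi.zero_apply] at this
    linear_combination this
  eq_zero_of_dy c hc h := smoothFun_ext fun ⟨x, y⟩ hp => by
    rw [map_zero, Pi.zero_apply, ← hc x hp.1]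
    have hd : ∀ s ∈ Set.Ioo a b, HasDerivAt (fun s => ext c (x, s)) 0 s := by
      intro s hs
      have := hasDerivAt_ext_y c (mem_square.2 ⟨hp.1, hs⟩)
      rwa [h, map_zero, Pi.zero_apply] at this
    exact isOpen_Ioo.is_const_of_deriv_eq_zero isPreconnected_Ioo
      (fun s hs => (hd s hs).differentiableAt.differentiableWithinAt)
      (fun s hs => (hd s hs).deriv) hp.2 hp.1
  N := N
  two_le := hN
  κ := κ
  κ_ne := hκ
  ux i := restr (fun p => u i p.1) (contDiffOn_fst_square (hu i))
  uy i := restr (fun p => u i p.2) (contDiffOn_snd_square (hu i))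
  dy_ux i := smoothFun_ext fun ⟨x, y⟩ hp => by
    refine (hasDerivAt_ext_y _ hp).unique ?_
    rw [map_zero, Pi.zero_apply]
    refine HasDerivAt.congr_of_eventuallyEq (hasDerivAt_const y (u i x)) ?_
    filter_upwards [isOpen_Ioo.mem_nhds hp.2] with s hs
    exact ext_restr _ (mem_square.2 ⟨hp.1, hs⟩)
  dx_uy i := smoothFun_ext fun ⟨x, y⟩ hp => by
    refine (hasDerivAt_ext_x _ hp).unique ?_
    rw [map_zero, Pi.zero_apply]
    refine HasDerivAt.congr_of_eventuallyEq (hasDerivAt_const x (u i y)) ?_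
    filter_upwards [isOpen_Ioo.mem_nhds hp.1] with s hs
    exact ext_restr _ (mem_square.2 ⟨hs, hp.2⟩)
  ux_sub_uy_mem i := fun x hx => by
    have hm := mem_square.2 ⟨hx, hx⟩
    rw [map_sub, Pi.sub_apply, ext_restr _ hm, ext_restr _ hm, sub_self]

/-! ### The functions represented by symbols -/

section Eval

variable {Ω : TopologicalSpace.Opens (ℝ × ℝ)}

/-- The value at `(x, y, t)` of the function with a given symbol. -/
def evalSym (N : ℕ) (κ x y t : ℝ) : (SmoothFun Ω)[X][X] →ₗ[ℂ] ℂ :=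
  lsum fun j => lsum fun k =>
    LinearMap.mulRight ℂ ((t : ℂ) ^ k * airyTerm N κ j x y t) ∘ₗ LinearMap.proj (x, y) ∘ₗ ext

variable {N : ℕ} {κ x y t : ℝ}

lemma evalSym_monomial (j : ℕ) (b : (SmoothFun Ω)[X]) : evalSym N κ x y t (monomial j b) =
    (b.sum fun k c => ext c (x, y) * (t : ℂ) ^ k) * airyTerm N κ j x y t := by
  rw [evalSym, lsum_apply, sum_monomial_index _ _ (by simp), lsum_apply, Polynomial.sum,
    Polynomial.sum, Finset.sum_mul]
  simp [mul_assoc]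

lemma evalSym_monomial_monomial (j k : ℕ) (c : SmoothFun Ω) :
    evalSym N κ x y t (monomial j (monomial k c)) =
      ext c (x, y) * (t : ℂ) ^ k * airyTerm N κ j x y t := by
  rw [evalSym_monomial, sum_monomial_index _ _ (by simp)]

lemma symbol_induction {A : Type*} [CommRing A] {motive : A[X][X] → Prop} (p : A[X][X])
    (add : ∀ p q, motive p → motive q → motive (p + q))
    (monomial : ∀ j k c, motive (monomial j (monomial k c))) : motive p := by
  induction p using Polynomial.induction_on' with
  | add p q hp hq => exact add p q hp hq
  | monomial j b =>
    induction b using Polynomial.induction_on' with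
    | add b b' hb hb' => rw [map_add]; exact add _ _ hb hb'
    | monomial k c => exact monomial j k c

lemma evalSym_t_mul (p : (SmoothFun Ω)[X][X]) :
    evalSym N κ x y t (C X * p) = t * evalSym N κ x y t p := by
  induction p using symbol_induction with
  | add p q hp hq => rw [mul_add, map_add, map_add, hp, hq, mul_add]
  | monomial j k c =>
    rw [C_mul_monomial, X_mul_monomial, evalSym_monomial_monomial, evalSym_monomial_monomial]
    ring

lemma evalSym_mulR (hp : (x, y) ∈ Ω) (d : SmoothFun Ω) (p : (SmoothFun Ω)[X][X]) :
    evalSym N κ x y t (TransportAlgebra.mulR d p) = ext d (x, y) * evalSym N κ x y t p := by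
  induction p using symbol_induction with
  | add p q hp hq => rw [map_add, map_add, map_add, hp, hq, mul_add]
  | monomial j k c =>
    rw [TransportAlgebra.mulR_apply, C_mul_monomial, C_mul_monomial, evalSym_monomial_monomial,
      evalSym_monomial_monomial, ext_mul _ _ hp]
    ring

lemma symOp_monomial {R : Type*} [CommRing R] [Algebra ℂ R] (d : Derivation ℂ R R) (j k : ℕ)
    (c : R) : TransportAlgebra.symOp d (monomial j (monomial k c)) =
      monomial j (monomial k (d c)) + monomial (j + 1) (monomial k c) := by
  rw [TransportAlgebra.symOp_apply, coeffDer_monomial, coeffDer_monomial, X_mul_monomial]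

variable (hN : 2 ≤ N) (hκ : IsHeatSign N κ)

include hN hκ

lemma hasDerivAt_evalSym_x (ht : 0 < t) (hp : (x, y) ∈ Ω) (p : (SmoothFun Ω)[X][X]) :
    HasDerivAt (fun s => evalSym N κ s y t p)
      (evalSym N κ x y t (TransportAlgebra.symOp (dirDer (Ω := Ω) (1, 0)) p)) x := by
  induction p using symbol_induction with
  | add p q hp hq => simpa only [map_add] using hp.fun_add hq
  | monomial j k c =>
    simp only [symOp_monomial, map_add, evalSym_monomial_monomial]
    refine (((hasDerivAt_ext_x c hp).mul_const ((t : ℂ) ^ k)).mul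
      (hasDerivAt_airyTerm_x hN hκ j x y ht)).congr_deriv ?_
    ring

lemma hasDerivAt_evalSym_y (ht : 0 < t) (hp : (x, y) ∈ Ω) (p : (SmoothFun Ω)[X][X]) :
    HasDerivAt (fun s => evalSym N κ x s t p)
      (-evalSym N κ x y t (TransportAlgebra.symOp (-dirDer (Ω := Ω) (0, 1)) p)) y := by
  induction p using symbol_induction with
  | add p q hp hq => simpa only [map_add, neg_add] using hp.fun_add hq
  | monomial j k c =>
    simp only [symOp_monomial, map_add, evalSym_monomial_monomial, Derivation.neg_apply, map_neg]
    refine (((hasDerivAt_ext_y c hp).mul_const ((t : ℂ) ^ k)).mul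
      (hasDerivAt_airyTerm_y hN hκ j x y ht)).congr_deriv ?_
    ring

lemma iteratedDeriv_evalSym_x (ht : 0 < t) (hp : (x, y) ∈ Ω) (p : (SmoothFun Ω)[X][X]) (i : ℕ) :
    iteratedDeriv i (fun s => evalSym N κ s y t p) x =
      evalSym N κ x y t ((TransportAlgebra.symOp (dirDer (Ω := Ω) (1, 0)) ^ i) p) := by
  induction i generalizing x with
  | zero => simp
  | succ i ih =>
    have h : iteratedDeriv i (fun s => evalSym N κ s y t p) =ᶠ[nhds x]
        fun s => evalSym N κ s y t ((TransportAlgebra.symOp (dirDer (Ω := Ω) (1, 0)) ^ i) p) := by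
      have : ∀ᶠ s in nhds x, (s, y) ∈ Ω :=
        (Ω.isOpen.preimage (Continuous.prodMk_left y)).mem_nhds hp
      filter_upwards [this] with s hs
      exact ih hs
    rw [iteratedDeriv_succ, h.deriv_eq, (hasDerivAt_evalSym_x hN hκ ht hp _).deriv, pow_succ',
      Module.End.mul_apply]

lemma iteratedDeriv_evalSym_y (ht : 0 < t) (hp : (x, y) ∈ Ω) (p : (SmoothFun Ω)[X][X]) (i : ℕ) :
    iteratedDeriv i (fun s => evalSym N κ x s t p) y =
      (-1) ^ i * evalSym N κ x y t ((TransportAlgebra.symOp (-dirDer (Ω := Ω) (0, 1)) ^ i) p) := by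
  induction i generalizing y with
  | zero => simp
  | succ i ih =>
    have h : iteratedDeriv i (fun s => evalSym N κ x s t p) =ᶠ[nhds y] fun s =>
        (-1) ^ i * evalSym N κ x s t ((TransportAlgebra.symOp (-dirDer (Ω := Ω) (0, 1)) ^ i) p) := by
      have : ∀ᶠ s in nhds y, (x, s) ∈ Ω :=
        (Ω.isOpen.preimage (Continuous.prodMk_right x)).mem_nhds hp
      filter_upwards [this] with s hs
      exact ih hs
    rw [iteratedDeriv_succ, h.deriv_eq,
      ((hasDerivAt_evalSym_y hN hκ ht hp _).const_mul _).deriv, pow_succ' (TransportAlgebra.symOp _),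
      Module.End.mul_apply]
    ring

end Eval

/-! ### From Hadamard coefficients on a square to congruences of symbols -/

namespace TransportAlgebra

variable {R : Type*} [CommRing R] [Algebra ℂ R] (S : TransportAlgebra R)

lemma opT_monomial (j k : ℕ) (c : R) : S.opT (monomial j (monomial k c)) =
    monomial j (monomial (k - 1) ((k : R) * c)) + S.κ • monomial (j + S.N) (monomial k c) := by
  rw [opT_apply, coeffDer_monomial, polyDer_apply, derivative_monomial, smul_mul_assoc,
    mul_comm c, X_pow_mul_monomial]

lemma nabla_monomial (j k : ℕ) (c : R) : S.nabla (monomial j (monomial k c)) =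
    monomial (j - 1) (monomial k ((j : R) * c)) + mulR S.w (monomial j (monomial k c))
      + (S.N * S.κ) • (C X * monomial (j + (S.N - 1)) (monomial k c)) := by
  rw [nabla_apply, derivative_monomial, add_mul, ← add_assoc, smul_mul_assoc, mul_assoc,
    mulR_apply, X_pow_mul_monomial, mul_comm, ← nsmul_eq_mul, smul_monomial, nsmul_eq_mul]

end TransportAlgebra

open TransportAlgebra

section Square

variable {a b : ℝ} {N : ℕ} {κ : ℝ} {u : ℕ → ℝ → ℂ} (hN : 2 ≤ N) (hκ : IsHeatSign N κ)
  (hu : ∀ i, ContDiffOn ℝ ∞ (u i) (Set.Ioo a b))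

lemma IsHeatSign.ofReal_ne_zero (hκ : IsHeatSign N κ) : (κ : ℂ) ≠ 0 :=
  Complex.ofReal_ne_zero.2 hκ.ne_zero

/-- The transport algebra of a heat equation on a square. -/
abbrev heatAlg : TransportAlgebra (SmoothFun (square a b)) :=
  squareAlg a b hN hκ.ofReal_ne_zero hu

variable {x y t : ℝ}

lemma hasDerivAt_evalSym_t (ht : 0 < t) (p : (SmoothFun (square a b))[X][X]) :
    HasDerivAt (fun s => evalSym N κ x y s p)
      (evalSym N κ x y t ((heatAlg hN hκ hu).opT p)) t := by
  induction p using symbol_induction with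
  | add p q hp hq => simpa only [map_add] using hp.fun_add hq
  | monomial j k c =>
    have h : evalSym N κ x y t ((heatAlg hN hκ hu).opT (monomial j (monomial k c))) =
        k * ext c (x, y) * (t : ℂ) ^ (k - 1) * airyTerm N κ j x y t +
          κ * (ext c (x, y) * (t : ℂ) ^ k * airyTerm N κ (j + N) x y t) := by
      rw [opT_monomial, map_add, map_smul, evalSym_monomial_monomial, evalSym_monomial_monomial,
        ext_natCast_mul]
      rfl
    rw [h]
    simp only [evalSym_monomial_monomial]
    have h1 : HasDerivAt (fun s : ℝ => (s : ℂ) ^ k) ((k : ℂ) * (t : ℂ) ^ (k - 1)) t :=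
      (hasDerivAt_pow k (t : ℂ)).comp_ofReal
    refine ((h1.const_mul (ext c (x, y))).mul
      (hasDerivAt_airyTerm_t hN hκ j x y ht)).congr_deriv ?_
    ring

lemma evalSym_nabla (ht : 0 < t) (hp : (x, y) ∈ square a b)
    (p : (SmoothFun (square a b))[X][X]) :
    evalSym N κ x y t ((heatAlg hN hκ hu).nabla p) = 0 := by
  induction p using symbol_induction with
  | add p q hp hq => rw [map_add, map_add, hp, hq, add_zero]
  | monomial j k c =>
    have h : evalSym N κ x y t ((heatAlg hN hκ hu).nabla (monomial j (monomial k c))) =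
        j * ext c (x, y) * (t : ℂ) ^ k * airyTerm N κ (j - 1) x y t +
          ext (heatAlg hN hκ hu).w (x, y) * (ext c (x, y) * (t : ℂ) ^ k * airyTerm N κ j x y t) +
          (N * κ) * (t * (ext c (x, y) * (t : ℂ) ^ k * airyTerm N κ (j + (N - 1)) x y t)) := by
      rw [nabla_monomial, map_add, map_add, map_smul, evalSym_mulR hp, evalSym_t_mul,
        evalSym_monomial_monomial, evalSym_monomial_monomial, evalSym_monomial_monomial,
        ext_natCast_mul]
      rfl
    have hw : ext (heatAlg hN hκ hu).w (x, y) = (x : ℂ) - y := ext_restr _ hp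
    rw [h, hw]
    linear_combination ext c (x, y) * (t : ℂ) ^ k * airyTerm_relation hN hκ j x y ht

lemma evalSym_red (ht : 0 < t) (hp : (x, y) ∈ square a b)
    (p : (SmoothFun (square a b))[X][X]) :
    evalSym N κ x y t ((heatAlg hN hκ hu).red p) = t * evalSym N κ x y t p := by
  obtain ⟨q, hq⟩ := (heatAlg hN hκ hu).red_sub_mem_range p
  rw [eq_sub_of_add_eq hq.symm, map_sub, evalSym_nabla hN hκ hu ht hp, sub_zero, evalSym_t_mul]

lemma evalSym_heatX (ht : 0 < t) (hp : (x, y) ∈ square a b)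
    (p : (SmoothFun (square a b))[X][X]) :
    evalSym N κ x y t ((heatAlg hN hκ hu).heatX p) =
      deriv (fun τ => evalSym N κ x y τ p) t -
        κ * opL N u (fun s => evalSym N κ s y t p) x := by
  have h : (heatAlg hN hκ hu).heatX p = (heatAlg hN hκ hu).opT p -
      (κ : ℂ) • ((symOp (dirDer (Ω := square a b) (1, 0)) ^ N) p + ∑ i ∈ Finset.range (N - 1),
        mulR ((heatAlg hN hκ hu).ux i) ((symOp (dirDer (Ω := square a b) (1, 0)) ^ i) p)) := by
    rw [heatX, LinearMap.sub_apply, LinearMap.smul_apply, LinearMap.add_apply,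
      LinearMap.sum_apply]
    rfl
  rw [h, map_sub, map_smul, map_add, map_sum, (hasDerivAt_evalSym_t hN hκ hu ht p).deriv,
    opL, iteratedDeriv_evalSym_x hN hκ ht hp, smul_eq_mul]
  congr 3
  refine Finset.sum_congr rfl fun i _ => ?_
  rw [evalSym_mulR hp, iteratedDeriv_evalSym_x hN hκ ht hp]
  congr 1
  exact ext_restr _ hp

lemma evalSym_heatY (ht : 0 < t) (hp : (x, y) ∈ square a b)
    (p : (SmoothFun (square a b))[X][X]) :
    evalSym N κ x y t ((heatAlg hN hκ hu).heatY p) =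
      deriv (fun τ => evalSym N κ x y τ p) t -
        κ * opLAdj N u (fun s => evalSym N κ x s t p) y := by
  have h : (heatAlg hN hκ hu).heatY p = (heatAlg hN hκ hu).opT p -
      (κ : ℂ) • ((symOp (-dirDer (Ω := square a b) (0, 1)) ^ N) p + ∑ i ∈ Finset.range (N - 1),
        (symOp (-dirDer (Ω := square a b) (0, 1)) ^ i) (mulR ((heatAlg hN hκ hu).uy i) p)) := by
    rw [heatY, LinearMap.sub_apply, LinearMap.smul_apply, LinearMap.add_apply,
      LinearMap.sum_apply]
    rfl
  have hsq : ∀ i : ℕ, ((-1 : ℂ) ^ i) * (-1) ^ i = 1 := fun i => by rw [← mul_pow]; simp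
  rw [h, map_sub, map_smul, map_add, map_sum, (hasDerivAt_evalSym_t hN hκ hu ht p).deriv,
    opLAdj, iteratedDeriv_evalSym_y hN hκ ht hp, smul_eq_mul, ← mul_assoc, hsq, one_mul]
  congr 3
  refine Finset.sum_congr rfl fun i _ => ?_
  have hev : (fun s => u i s * evalSym N κ x s t p) =ᶠ[nhds y]
      fun s => evalSym N κ x s t (mulR ((heatAlg hN hκ hu).uy i) p) := by
    filter_upwards [isOpen_Ioo.mem_nhds hp.2] with s hs
    have hm := mem_square.2 ⟨hp.1, hs⟩
    rw [evalSym_mulR hm]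
    have hui : ext ((heatAlg hN hκ hu).uy i) (x, s) = u i s := ext_restr _ hm
    rw [hui]
  rw [hev.iteratedDeriv_eq, iteratedDeriv_evalSym_y hN hκ ht hp, ← mul_assoc, hsq, one_mul]

lemma evalSym_eq_sum (hp : (x, y) ∈ square a b) {p : (SmoothFun (square a b))[X][X]} {m : ℕ}
    (h : p ∈ degreeLT (SmoothFun (square a b))[X] m) :
    evalSym N κ x y t p = ∑ j ∈ Finset.range m,
      ((p.coeff j).map (evalHom (Ω := square a b) ⟨(x, y), hp⟩).toRingHom).eval (t : ℂ) *
        airyTerm N κ j x y t := by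
  have hsum : p = ∑ j ∈ Finset.range m, monomial j (p.coeff j) := by
    rw [mem_degreeLT_iff_coeff] at h
    ext1 n
    rw [finsetSum_coeff]
    simp only [coeff_monomial, Finset.sum_ite_eq', Finset.mem_range]
    split_ifs with hn
    · rfl
    · exact h n (by omega)
  conv_lhs => rw [hsum, map_sum]
  refine Finset.sum_congr rfl fun j _ => ?_
  rw [evalSym_monomial, eval_map, eval₂_eq_sum]
  congr 2
  ext k c
  rw [ext_apply c hp]
  rfl

/-- If a symbol represents a function of order `t ^ K`, its reduction is divisible by
`t ^ (K + 1)`. -/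
lemma dvd_red_of_evalSym {K : ℕ} {Z : (SmoothFun (square a b))[X][X]}
    (hZ : Z ∈ degreeLT (SmoothFun (square a b))[X] (2 * (N - 1))) (r : ℕ → ℝ → ℝ → ℂ)
    (h : ∀ x y t : ℝ, (x, y) ∈ square a b → 0 < t → evalSym N κ x y t Z =
      (t : ℂ) ^ K * ∑ j ∈ Finset.range (N - 1), r j x y * airyTerm N κ j x y t) :
    C X ^ (K + 1) ∣ (heatAlg hN hκ hu).red Z := by
  have hred : (heatAlg hN hκ hu).red Z ∈ degreeLT (SmoothFun (square a b))[X] (N - 1) :=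
    (heatAlg hN hκ hu).red_mem hZ
  rw [← C_pow, C_dvd_iff_dvd_coeff]
  intro j
  rcases lt_or_ge j (N - 1) with hj | hj
  swap
  · rw [mem_degreeLT_iff_coeff.1 hred j hj]
    exact dvd_zero _
  rw [X_pow_dvd_iff]
  intro k hk
  -- Independence is available only for `x ≠ y`; multiplication by `w` settles the diagonal and is
  -- injective.
  refine (heatAlg hN hκ hu).eq_zero_of_w_mul (smoothFun_ext fun ⟨x, y⟩ hp => ?_)
  have hw : ext (heatAlg hN hκ hu).w (x, y) = (x : ℂ) - y := ext_restr _ hp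
  rw [ext_mul _ _ hp, map_zero, Pi.zero_apply, hw]
  rcases eq_or_ne x y with rfl | hxy
  · rw [sub_self, zero_mul]
  -- For fixed `(x, y)`, `r j x y` is a constant, so subtracting `r t^{K+1}` leaves the coefficients
  -- of `t^k`, `k ≤ K`, unchanged.
  have hind := airyTerm_independent hN hκ hxy
    (fun j => (((heatAlg hN hκ hu).red Z).coeff j).map
        (evalHom (Ω := square a b) ⟨(x, y), hp⟩).toRingHom -
      C (r j x y) * X ^ (K + 1)) (fun t ht => by
        have h1 := evalSym_red hN hκ hu ht hp Z
        rw [evalSym_eq_sum hp hred, h x y t hp ht, ← mul_assoc, ← pow_succ'] at h1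
        simp only [eval_sub, sub_mul, Finset.sum_sub_distrib]
        rw [h1, sub_eq_zero, Finset.mul_sum]
        refine Finset.sum_congr rfl fun j _ => ?_
        simp only [eval_mul, eval_C, eval_pow, eval_X]
        ring) j hj
  have := congrArg (fun q => q.coeff k) hind
  simp only [coeff_sub, coeff_map, coeff_C_mul_X_pow, if_neg (show ¬ k = K + 1 by omega), sub_zero,
    coeff_zero] at this
  rw [ext_apply _ hp]
  exact mul_eq_zero_of_right _ this

/-- The symbol of the truncated heat kernel expansion. -/
def truncSym {Ω : TopologicalSpace.Opens (ℝ × ℝ)} (N K : ℕ) (g : ℕ → ℕ → SmoothFun Ω) :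
    (SmoothFun Ω)[X][X] :=
  1 + ∑ j ∈ Finset.range (N - 1), monomial j (∑ k ∈ Finset.Icc 1 K, monomial k (g k j))

lemma truncSym_mem (hN : 2 ≤ N) {Ω : TopologicalSpace.Opens (ℝ × ℝ)} (K : ℕ)
    (g : ℕ → ℕ → SmoothFun Ω) : truncSym N K g ∈ degreeLT (SmoothFun Ω)[X] (N - 1) := by
  rw [mem_degreeLT_iff_coeff]
  intro n hn
  rw [truncSym, coeff_add, coeff_one, if_neg (by omega), zero_add, finsetSum_coeff]
  refine Finset.sum_eq_zero fun j hj => ?_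
  have := Finset.mem_range.1 hj
  rw [coeff_monomial, if_neg (by omega)]

lemma coeff_truncSym_sub_one {Ω : TopologicalSpace.Opens (ℝ × ℝ)} (K : ℕ)
    (g : ℕ → ℕ → SmoothFun Ω) (j k : ℕ) : ((truncSym N K g - 1).coeff j).coeff k =
      if j < N - 1 ∧ 1 ≤ k ∧ k ≤ K then g k j else 0 := by
  rw [truncSym, add_sub_cancel_left, finsetSum_coeff]
  simp only [coeff_monomial, Finset.sum_ite_eq', Finset.mem_range]
  by_cases hj : j < N - 1
  · rw [if_pos hj, finsetSum_coeff]
    simp only [coeff_monomial, Finset.sum_ite_eq', Finset.mem_Icc, hj, true_and]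
  · simp [hj]

lemma dvd_truncSym_sub_one {Ω : TopologicalSpace.Opens (ℝ × ℝ)} (K : ℕ)
    (g : ℕ → ℕ → SmoothFun Ω) : C X ∣ truncSym N K g - 1 := by
  rw [C_dvd_iff_dvd_coeff]
  intro j
  rw [X_dvd_iff, coeff_truncSym_sub_one, if_neg (by omega)]

lemma evalSym_truncSym {Ω : TopologicalSpace.Opens (ℝ × ℝ)} (hp : (x, y) ∈ Ω) (K : ℕ)
    (g : ℕ → ℕ → SmoothFun Ω) : evalSym N κ x y t (truncSym N K g) =
      airyTerm N κ 0 x y t + ∑ j ∈ Finset.range (N - 1),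
        airyTerm N κ j x y t * ∑ k ∈ Finset.Icc 1 K, ext (g k j) (x, y) * (t : ℂ) ^ k := by
  have h1 : (1 : (SmoothFun Ω)[X][X]) = monomial 0 (monomial 0 1) := rfl
  rw [truncSym, map_add, map_sum, h1, evalSym_monomial_monomial, ext_one hp, pow_zero, one_mul,
    one_mul]
  congr 1
  refine Finset.sum_congr rfl fun j _ => ?_
  rw [map_sum, map_sum, Finset.mul_sum]
  refine Finset.sum_congr rfl fun k _ => ?_
  rw [evalSym_monomial_monomial]
  ring

lemma exists_coeff {Ω : TopologicalSpace.Opens (ℝ × ℝ)} {F : ℕ → ℕ → ℝ → ℝ → ℂ}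
    (hF : ∀ k j : ℕ, 1 ≤ k → j < N - 1 → ContDiffOn ℝ ∞ (fun p : ℝ × ℝ => F k j p.1 p.2) Ω) :
    ∃ g : ℕ → ℕ → SmoothFun Ω, ∀ k j : ℕ, 1 ≤ k → j < N - 1 → ∀ x y : ℝ, (x, y) ∈ Ω →
      ext (g k j) (x, y) = F k j x y := by
  classical
  refine ⟨fun k j => if h : 1 ≤ k ∧ j < N - 1 then restr _ (hF k j h.1 h.2) else 0,
    fun k j hk hj x y hp => ?_⟩
  simp only [dif_pos (And.intro hk hj)]
  exact ext_restr _ hp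

lemma evalSym_truncSym_eq {Ω : TopologicalSpace.Opens (ℝ × ℝ)} {F : ℕ → ℕ → ℝ → ℝ → ℂ}
    {g : ℕ → ℕ → SmoothFun Ω} (hg : ∀ k j : ℕ, 1 ≤ k → j < N - 1 → ∀ x y : ℝ, (x, y) ∈ Ω →
      ext (g k j) (x, y) = F k j x y) (K : ℕ) (hp : (x, y) ∈ Ω) :
    evalSym N κ x y t (truncSym N K g) = heatKernelTrunc N κ F K x y t := by
  rw [evalSym_truncSym hp, heatKernelTrunc]
  congr 1
  refine Finset.sum_congr rfl fun j hj => ?_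
  congr 1
  refine Finset.sum_congr rfl fun k hk => ?_
  rw [hg k j (Finset.mem_Icc.1 hk).1 (Finset.mem_range.1 hj) x y hp]

lemma heatKernelTrunc_dual (hκ : IsHeatSign N κ) (F : ℕ → ℕ → ℝ → ℝ → ℂ) (K : ℕ) (x y t : ℝ) :
    heatKernelTrunc N ((-1) ^ N * κ) F K y x t =
      heatKernelTrunc N κ (fun k j x y => (-1) ^ j * F k j y x) K x y t := by
  rw [heatKernelTrunc, heatKernelTrunc, airyTerm_dual hκ, pow_zero, one_mul]
  congr 1
  refine Finset.sum_congr rfl fun j _ => ?_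
  rw [airyTerm_dual hκ, Finset.mul_sum, Finset.mul_sum]
  exact Finset.sum_congr rfl fun k _ => by ring

lemma opL_congr {f g : ℝ → ℂ} (h : f =ᶠ[nhds x] g) : opL N u f x = opL N u g x := by
  rw [opL, opL, h.iteratedDeriv_eq]
  congr 1
  exact Finset.sum_congr rfl fun i _ => by rw [h.iteratedDeriv_eq]

lemma opLAdj_congr {f g : ℝ → ℂ} (h : f =ᶠ[nhds x] g) : opLAdj N u f x = opLAdj N u g x := by
  rw [opLAdj, opLAdj, h.iteratedDeriv_eq]
  congr 1
  refine Finset.sum_congr rfl fun i _ => ?_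
  have : (fun s => u i s * f s) =ᶠ[nhds x] fun s => u i s * g s :=
    h.mono fun s hs => by simp only [hs]
  rw [this.iteratedDeriv_eq]

/-- The symmetry of the Hadamard coefficients on a square. -/
theorem hadamard_symm_square {V U : Set (ℝ × ℝ)} (hU : (square a b : Set (ℝ × ℝ)) ⊆ U)
    (hV : ∀ x y, (x, y) ∈ square a b → (y, x) ∈ V) {H Ht : ℕ → ℕ → ℝ → ℝ → ℂ}
    (hH : IsHadamard N κ (fun f x => (κ : ℂ) * opL N u f x) U H)
    (hHt : IsHadamard N ((-1) ^ N * κ) (fun f x => (κ : ℂ) * opLAdj N u f x) V Ht)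
    (hN : 2 ≤ N) (hκ : IsHeatSign N κ) (hu : ∀ i, ContDiffOn ℝ ∞ (u i) (Set.Ioo a b))
    (hp : (x, y) ∈ square a b) {n j : ℕ} (hn : 1 ≤ n) (hj : j < N - 1) :
    H n j x y = (-1) ^ j * Ht n j y x := by
  obtain ⟨g, hg⟩ := exists_coeff (Ω := square a b) (F := H) (N := N)
    fun k j hk hj => (hH.smooth k j hk hj).mono hU
  obtain ⟨g', hg'⟩ := exists_coeff (Ω := square a b) (N := N)
    (F := fun k j x y => (-1) ^ j * Ht k j y x) fun k j hk hj =>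
      contDiffOn_const.mul ((hHt.smooth k j hk hj).comp
        (contDiff_snd.prodMk contDiff_fst).contDiffOn fun p hp => hV p.1 p.2 hp)
  have hmem := truncSym_mem hN n g
  have hmem' := truncSym_mem hN n g'
  have hx : C X ^ (n + 1) ∣ (heatAlg hN hκ hu).red ((heatAlg hN hκ hu).heatX (truncSym N n g)) := by
    obtain ⟨r, hr⟩ := hH.solves n
    refine dvd_red_of_evalSym hN hκ hu ((heatAlg hN hκ hu).isHeatOp_heatX.apply_mem hmem) r
      fun x y t hp ht => ?_
    rw [evalSym_heatX hN hκ hu ht hp, ← hr x y t (hU hp) ht]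
    congr 2
    · exact funext fun τ => evalSym_truncSym_eq hg n hp
    · refine opL_congr ?_
      filter_upwards [isOpen_Ioo.mem_nhds hp.1] with s hs
      exact evalSym_truncSym_eq hg n (mem_square.2 ⟨hs, hp.2⟩)
  have hy : C X ^ (n + 1) ∣ (heatAlg hN hκ hu).red ((heatAlg hN hκ hu).heatY (truncSym N n g')) := by
    obtain ⟨r, hr⟩ := hHt.solves n
    refine dvd_red_of_evalSym hN hκ hu ((heatAlg hN hκ hu).isHeatOp_heatY.apply_mem hmem')
      (fun j x y => (-1) ^ j * r j y x) fun x y t hp ht => ?_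
    have hr' := hr y x t (hV x y hp) ht
    simp only [airyTerm_dual hκ, heatKernelTrunc_dual hκ] at hr'
    rw [evalSym_heatY hN hκ hu ht hp]
    refine Eq.trans ?_ (hr'.trans ?_)
    · congr 2
      · exact funext fun τ => evalSym_truncSym_eq hg' n hp
      · refine opLAdj_congr ?_
        filter_upwards [isOpen_Ioo.mem_nhds hp.2] with s hs
        exact evalSym_truncSym_eq hg' n (mem_square.2 ⟨hp.1, hs⟩)
    · congr 1
      exact Finset.sum_congr rfl fun j _ => by ring
  -- Truncation at `t^n` suffices: a congruence modulo `t^{n+1}` determines the coefficient of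
  -- `t^n`.
  have hdvd := (heatAlg hN hκ hu).dvd_sub_of_dual hn hmem hmem' (dvd_truncSym_sub_one n g)
    (dvd_truncSym_sub_one n g') hx hy
  rw [← C_pow, C_dvd_iff_dvd_coeff] at hdvd
  have h1 := X_pow_dvd_iff.1 (hdvd j) n (by omega)
  rw [← sub_sub_sub_cancel_right _ _ 1, coeff_sub, coeff_sub, coeff_truncSym_sub_one,
    coeff_truncSym_sub_one, if_pos ⟨hj, hn, le_rfl⟩, if_pos ⟨hj, hn, le_rfl⟩, sub_eq_zero] at h1
  rw [← hg n j hn hj x y hp, h1, hg' n j hn hj x y hp]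

end Square

/-! ### Passage from a closed square to an open one -/

lemma exists_mem_Icc_dist_lt {m M δ p : ℝ} (hmM : m ≤ M) (hδ : 0 < δ)
    (hp : p ∈ Set.Ioo (m - δ) (M + δ)) : ∃ p' ∈ Set.Icc m M, dist p p' < δ := by
  obtain ⟨h1, h2⟩ := hp
  rcases lt_or_ge p m with h | h
  · exact ⟨m, ⟨le_rfl, hmM⟩, by rw [Real.dist_eq, abs_lt]; constructor <;> linarith⟩
  rcases lt_or_ge M p with h' | h'
  · exact ⟨M, ⟨hmM, le_rfl⟩, by rw [Real.dist_eq, abs_lt]; constructor <;> linarith⟩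
  · exact ⟨p, ⟨h, h'⟩, by simpa using hδ⟩

/-- A square over a compact interval in an open set has a neighbourhood which is a square. -/
lemma exists_square_subset {x y : ℝ} {W : Set (ℝ × ℝ)} (hW : IsOpen W)
    (h : Set.uIcc x y ×ˢ Set.uIcc x y ⊆ W) :
    ∃ a b : ℝ, (x, y) ∈ square a b ∧ (square a b : Set (ℝ × ℝ)) ⊆ W := by
  obtain ⟨δ, hδ, hsub⟩ := (isCompact_uIcc.prod isCompact_uIcc).exists_thickening_subset_open hW h
  -- The distance on `ℝ × ℝ` is the maximum of the two distances, so widening the interval by `δ` on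
  -- either side stays within the `δ`-thickening of the closed square.
  refine ⟨min x y - δ, max x y + δ, mem_square.2 ⟨⟨?_, ?_⟩, ⟨?_, ?_⟩⟩, fun p hp => hsub ?_⟩
  · linarith [min_le_left x y]
  · linarith [le_max_left x y]
  · linarith [min_le_right x y]
  · linarith [le_max_right x y]
  · obtain ⟨p₁, h₁, d₁⟩ := exists_mem_Icc_dist_lt min_le_max hδ hp.1
    obtain ⟨p₂, h₂, d₂⟩ := exists_mem_Icc_dist_lt min_le_max hδ hp.2
    exact Metric.mem_thickening_iff.2 ⟨(p₁, p₂), ⟨h₁, h₂⟩, max_lt d₁ d₂⟩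

end HeatExpansion

end

open HeatExpansion in
theorem corollary4p6 (N : ℕ) (hN : 2 ≤ N) (κ : ℝ) (hκ : IsHeatSign N κ)
    (I : Set ℝ) (hI : IsOpen I)
    (u : ℕ → ℝ → ℂ) (hu : ∀ i < N - 1, ContDiffOn ℝ ∞ (u i) I)
    -- neighbourhoods of the diagonal on which the two families of coefficients are defined
    (U V : Set (ℝ × ℝ)) (hU : IsOpen U) (hV : IsOpen V)
    (hUI : U ⊆ I ×ˢ I) (hVI : V ⊆ I ×ˢ I)
    (hUdiag : ∀ x ∈ I, (x, x) ∈ U) (hVdiag : ∀ x ∈ I, (x, x) ∈ V)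
    (H Ht : ℕ → ℕ → ℝ → ℝ → ℂ)
    -- `∂_t v = κ L v`
    (hH : IsHadamard N κ (fun f x => (κ : ℂ) * opL N u f x) U H)
    -- `∂_t v = κ L^* v`, whose leading term is `(-1)^N κ ∂^N`
    (hHt : IsHadamard N ((-1) ^ N * κ) (fun f x => (κ : ℂ) * opLAdj N u f x) V Ht) :
    ∀ x y : ℝ, Set.uIcc x y ×ˢ Set.uIcc x y ⊆ U → Set.uIcc x y ×ˢ Set.uIcc x y ⊆ V →
      ∀ n j : ℕ, 1 ≤ n → j < N - 1 → H n j x y = (-1) ^ j * Ht n j y x := by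
  intro x y hxyU hxyV n j hn hj
  obtain ⟨a, b, hp, hsub⟩ := exists_square_subset (hU.inter (hV.preimage continuous_swap))
    (Set.subset_inter hxyU fun p hp => hxyV ⟨hp.2, hp.1⟩)
  have hIoo : Set.Ioo a b ⊆ I := fun s hs => (hUI (hsub (mem_square.2 ⟨hs, hs⟩)).1).1
  -- `squareAlg` takes all the `u i` to be smooth; those with `i ≥ N - 1` do not occur in the
  -- operators and are replaced by zero.
  set u' : ℕ → ℝ → ℂ := fun i => if i < N - 1 then u i else 0 with hu'
  have hu'i : ∀ i ∈ Finset.range (N - 1), u' i = u i := fun i hi =>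
    if_pos (Finset.mem_range.1 hi)
  have hL : opL N u = opL N u' := by
    ext f x
    rw [opL, opL]
    congr 1
    exact Finset.sum_congr rfl fun i hi => by rw [hu'i i hi]
  have hLA : opLAdj N u = opLAdj N u' := by
    ext f x
    rw [opLAdj, opLAdj]
    congr 1
    exact Finset.sum_congr rfl fun i hi => by rw [hu'i i hi]
  rw [hL] at hH
  rw [hLA] at hHt
  refine hadamard_symm_square (fun p hp => (hsub hp).1) (fun x y hp => (hsub hp).2) hH hHt hN hκ
    (fun i => ?_) hp hn hj
  by_cases hi : i < N - 1
  · simp only [hu', if_pos hi]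
    exact (hu i hi).mono hIoo
  · simp only [hu', if_neg hi]
    exact contDiffOn_const
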